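/- Let $F$ be a non-archimedean locally compact field, $D$ a central division algebra of finite dimension over $F$ and $m\ge 1$ an integer. Let $\mathcal O_D$ be the ring of integers of $D$, $\wp_D$ its maximal ideal, $\varpi$ a uniformizer (so $\wp_D=\varpi\mathcal O_D$) and $\mathfrak k_D=\mathcal O_D/\wp_D$. Put $G=GL_m(D)$, $K=GL_m(\mathcal O_D)$ and $K^1=\mathbb I_m+M_m(\wp_D)$. Let $\mathscr H(G,K^1)$ be the unital $\mathbb Z$-algebra of functions $\Phi:G\to\mathbb Z$ such that $\Phi(kgk')=\Phi(g)$ for all $k,k'\in K^1$, $g\in G$, and whose support is a finite union of $K^1$-double cosets, with product $(\Phi_1*\Phi_2)(g)=\sum_x\Phi_1(x)\Phi_2(x^{-1}g)$, where $x$ runs over a system of representatives of $G/K^1$. Let $\mathscr H(K,K^1)$ be its subalgebra of functions supported in $K$, and for $x\in G$ let $f_x$ be the characteristic function of $K^1xK^1$. For $0\le i\le m-1$ let $\tau_i=\mathrm{diag}(1,\dots,1,\varpi,\dots,\varpi)$, with $i$ entries $1$ followed by $m-i$ entries $\varpi$. Let $\Sigma=\{\alpha_{i,i+1}\mid 1\le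 i\le m-1\}$ be the set of simple roots; for $\alpha=\alpha_{i,i+1}\in\Sigma$ put $\tau_\alpha=\tau_i$ and let $s_\alpha\in G$ be the permutation matrix of the transposition $(i,i+1)$. Put $\Omega=K\cup\{\tau_0,\tau_0^{-1}\}\cup\{\tau_\alpha\mid\alpha\in\Sigma\}$. Then: 1. the set $\{f_\omega\mid\omega\in\Omega\}$ is finite and generates $\mathscr H(G,K^1)$ as a $\mathbb Z$-algebra; 2. let $U$ be the group of upper unipotent matrices in $K$ and, for any multiplicative section $\sigma:\mathfrak k_D^\times\to\mathcal O_D^\times$ of the reduction map, let $T$ be the group of diagonal matrices with entries in $\sigma(\mathfrak k_D^\times)$. Then the subalgebra $\mathscr H(K,K^1)$ is generated as a $\mathbb Z$-algebra by the elements $f_u$, $f_t$, $f_{s_\alpha}$ with $u\in U$, $t\in T$, $\alpha\in\Sigma$. -/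

import Mathlib

/-- `(G, H)` is a Hecke pair: every double coset `HgH` is a finite union of left cosets `xH`. -/
class IsHeckePair {G : Type*} [Group G] (H : Subgroup G) : Prop where
  finite_leftCosets : ∀ g : G,
    ((fun x : G => (x : G ⧸ H)) '' DoubleCoset.doubleCoset g (H : Set G) (H : Set G)).Finite

section HeckeAlgebra

open DoubleCoset

variable {G : Type*} [Group G] (H : Subgroup G)

/-- `Φ (h * g * k) = Φ g` for all `h, k ∈ H` and `g ∈ G`. -/
def IsBiinvariant (Φ : G → ℤ) : Prop :=
  ∀ h ∈ H, ∀ k ∈ H, ∀ g, Φ (h * g * k) = Φ g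

/-- The support of `Φ` is a finite union of `H`-double cosets. -/
def HasFiniteDoubleCosetSupport (Φ : G → ℤ) : Prop :=
  ∃ S : Finset G, Function.support Φ = ⋃ x ∈ S, doubleCoset x (H : Set G) (H : Set G)

variable {H}

theorem IsBiinvariant.apply_mul_right {Φ : G → ℤ} (hΦ : IsBiinvariant H Φ) (g : G) {k : G}
    (hk : k ∈ H) : Φ (g * k) = Φ g := by
  simpa using hΦ 1 H.one_mem k hk g

theorem IsBiinvariant.apply_mul_left {Φ : G → ℤ} (hΦ : IsBiinvariant H Φ) (g : G) {h : G}
    (hh : h ∈ H) : Φ (h * g) = Φ g := by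
  simpa using hΦ h hh 1 H.one_mem g

theorem IsBiinvariant.apply_eq_of_mem {Φ : G → ℤ} (hΦ : IsBiinvariant H Φ) {x y : G}
    (h : y ∈ doubleCoset x (H : Set G) (H : Set G)) : Φ y = Φ x := by
  obtain ⟨a, ha, b, hb, rfl⟩ := mem_doubleCoset.mp h
  exact hΦ a ha b hb x

/-- For biinvariant functions it is enough that the support is covered by finitely many double
cosets. -/
theorem IsBiinvariant.hasFiniteDoubleCosetSupport_of_subset {Φ : G → ℤ} (hΦ : IsBiinvariant H Φ)
    (S : Finset G)
    (hS : Function.support Φ ⊆ ⋃ x ∈ S, doubleCoset x (H : Set G) (H : Set G)) :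
    HasFiniteDoubleCosetSupport H Φ := by
  classical
  refine ⟨S.filter (fun x => Φ x ≠ 0), Set.Subset.antisymm ?_ ?_⟩
  · intro y hy
    obtain ⟨x, hx, hyx⟩ := Set.mem_iUnion₂.mp (hS hy)
    refine Set.mem_iUnion₂.mpr ⟨x, Finset.mem_filter.mpr ⟨hx, ?_⟩, hyx⟩
    rw [← hΦ.apply_eq_of_mem hyx]
    exact hy
  · intro y hy
    obtain ⟨x, hx, hyx⟩ := Set.mem_iUnion₂.mp hy
    rw [Function.mem_support, hΦ.apply_eq_of_mem hyx]
    exact (Finset.mem_filter.mp hx).2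

theorem IsBiinvariant.hasFiniteDoubleCosetSupport_of_finite {Φ : G → ℤ} (hΦ : IsBiinvariant H Φ)
    (hf : ((fun x : G => (x : G ⧸ H)) '' Function.support Φ).Finite) :
    HasFiniteDoubleCosetSupport H Φ := by
  classical
  refine hΦ.hasFiniteDoubleCosetSupport_of_subset (hf.toFinset.image Quotient.out) ?_
  intro y hy
  refine Set.mem_iUnion₂.mpr ⟨(y : G ⧸ H).out, Finset.mem_image.mpr
    ⟨(y : G ⧸ H), hf.mem_toFinset.mpr ⟨y, hy, rfl⟩, rfl⟩, ?_⟩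
  refine mem_doubleCoset.mpr ⟨1, H.one_mem, (y : G ⧸ H).out⁻¹ * y, ?_, by simp⟩
  exact QuotientGroup.eq.mp (QuotientGroup.out_eq' (y : G ⧸ H))

theorem HasFiniteDoubleCosetSupport.finite [IsHeckePair H] {Φ : G → ℤ}
    (hΦ : HasFiniteDoubleCosetSupport H Φ) :
    ((fun x : G => (x : G ⧸ H)) '' Function.support Φ).Finite := by
  obtain ⟨S, hS⟩ := hΦ
  rw [hS, Set.image_iUnion₂]
  exact S.finite_toSet.biUnion fun x _ => IsHeckePair.finite_leftCosets x

variable (H)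

/-- The functions `G → ℤ` that are biinvariant under `H` and whose support is a finite union of
`H`-double cosets, as a subgroup of the additive group of all functions. -/
def heckeFunctions : AddSubgroup (G → ℤ) where
  carrier := {Φ | IsBiinvariant H Φ ∧ HasFiniteDoubleCosetSupport H Φ}
  zero_mem' := ⟨fun _ _ _ _ _ => rfl, ∅, by simp⟩
  add_mem' := by
    classical
    rintro Φ Ψ ⟨hΦ, S, hS⟩ ⟨hΨ, T, hT⟩
    have hb : IsBiinvariant H (Φ + Ψ) := fun h hh k hk g => by
      simp only [Pi.add_apply, hΦ h hh k hk g, hΨ h hh k hk g]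
    refine ⟨hb, hb.hasFiniteDoubleCosetSupport_of_subset (S ∪ T) ?_⟩
    intro x hx
    rw [Finset.set_biUnion_union, ← hS, ← hT]
    exact Function.support_add Φ Ψ hx
  neg_mem' := by
    rintro Φ ⟨hΦ, S, hS⟩
    exact ⟨fun h hh k hk g => by simp only [Pi.neg_apply, hΦ h hh k hk g], S, by
      rw [← hS]; ext x; simp⟩

/-- The Hecke algebra `ℋ(G, H)`, here as an additive group; for a Hecke pair it is a ring under
convolution. -/
def HeckeAlgebra : Type _ := heckeFunctions H

namespace HeckeAlgebra

noncomputable instance : AddCommGroup (HeckeAlgebra H) :=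
  inferInstanceAs (AddCommGroup (heckeFunctions H))

instance : FunLike (HeckeAlgebra H) G ℤ where
  coe Φ := Φ.1
  coe_injective _ _ h := Subtype.ext h

variable {H}

@[ext]
theorem ext {Φ Ψ : HeckeAlgebra H} (h : ∀ g, Φ g = Ψ g) : Φ = Ψ := DFunLike.ext _ _ h

theorem isBiinvariant (Φ : HeckeAlgebra H) : IsBiinvariant H Φ := Φ.2.1

theorem hasFiniteDoubleCosetSupport (Φ : HeckeAlgebra H) : HasFiniteDoubleCosetSupport H Φ := Φ.2.2

@[simp] theorem add_apply (Φ Ψ : HeckeAlgebra H) (g : G) : (Φ + Ψ) g = Φ g + Ψ g := rfl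
@[simp] theorem neg_apply (Φ : HeckeAlgebra H) (g : G) : (-Φ) g = -Φ g := rfl
@[simp] theorem zero_apply (g : G) : (0 : HeckeAlgebra H) g = 0 := rfl

/-- The sum of `f x`, where `x` runs over a system of representatives of `G / H`. -/
noncomputable def cosetSum (H : Subgroup G) (f : G → ℤ) : ℤ := ∑ᶠ q : G ⧸ H, f q.out

theorem apply_out {f : G → ℤ} (hf : ∀ x, ∀ h ∈ H, f (x * h) = f x) (x : G) :
    f (x : G ⧸ H).out = f x := by
  have h := hf x (x⁻¹ * (x : G ⧸ H).out)
    (QuotientGroup.eq.mp (QuotientGroup.out_eq' (x : G ⧸ H)).symm)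
  simpa using h

theorem cosetSum_mul_left {f : G → ℤ} (hf : ∀ x, ∀ h ∈ H, f (x * h) = f x) (c : G) :
    cosetSum H (fun x => f (c * x)) = cosetSum H f := by
  unfold cosetSum
  rw [← finsum_comp_equiv (MulAction.toPerm c : Equiv.Perm (G ⧸ H)) (f := fun q => f q.out)]
  refine finsum_congr fun q => ?_
  have : (MulAction.toPerm c : Equiv.Perm (G ⧸ H)) q = ((c * q.out : G) : G ⧸ H) := by
    rw [MulAction.toPerm_apply]
    conv_lhs => rw [← QuotientGroup.out_eq' q]
    rfl
  rw [this, apply_out hf]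

theorem cosetSum_single {f : G → ℤ} (hf : ∀ x, ∀ h ∈ H, f (x * h) = f x) (c : G)
    (h0 : ∀ x, f x ≠ 0 → c⁻¹ * x ∈ H) : cosetSum H f = f c := by
  unfold cosetSum
  rw [finsum_eq_single _ (c : G ⧸ H), apply_out hf]
  intro q hq
  by_contra hne
  exact hq ((QuotientGroup.out_eq' q).symm.trans (QuotientGroup.eq.mpr (h0 _ hne)).symm)

/-- The convolution `(Φ * Ψ)(g) = ∑ₓ Φ(x) Ψ(x⁻¹ g)`, where `x` runs over a system of
representatives of `G / H`. -/
noncomputable def conv (H : Subgroup G) (Φ Ψ : G → ℤ) (g : G) : ℤ :=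
  cosetSum H fun x => Φ x * Ψ (x⁻¹ * g)

theorem term_mul_right {Φ Ψ : G → ℤ} (hΦ : IsBiinvariant H Φ) (hΨ : IsBiinvariant H Ψ) (g x : G)
    (h : G) (hh : h ∈ H) : Φ (x * h) * Ψ ((x * h)⁻¹ * g) = Φ x * Ψ (x⁻¹ * g) := by
  rw [hΦ.apply_mul_right x hh, mul_inv_rev, mul_assoc, hΨ.apply_mul_left _ (H.inv_mem hh)]

theorem isBiinvariant_conv {Φ Ψ : G → ℤ} (hΦ : IsBiinvariant H Φ) (hΨ : IsBiinvariant H Ψ) :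
    IsBiinvariant H (conv H Φ Ψ) := by
  intro h hh k hk g
  unfold conv
  rw [← cosetSum_mul_left (term_mul_right hΦ hΨ (h * g * k)) h]
  congr 1
  funext x
  rw [hΦ.apply_mul_left x hh, show (h * x)⁻¹ * (h * g * k) = x⁻¹ * g * k by group,
    hΨ.apply_mul_right _ hk]

theorem exists_of_conv_ne_zero {Φ Ψ : G → ℤ} {g : G} (h : conv H Φ Ψ g ≠ 0) :
    ∃ q : G ⧸ H, Φ q.out ≠ 0 ∧ Ψ (q.out⁻¹ * g) ≠ 0 := by
  by_contra! hne
  apply h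
  unfold conv cosetSum
  refine finsum_eq_zero_of_forall_eq_zero fun q => ?_
  by_cases h0 : Φ q.out = 0
  · simp [h0]
  · simp [hne q h0]

theorem finite_out [IsHeckePair H] {Φ : G → ℤ} (hΦ : HasFiniteDoubleCosetSupport H Φ) :
    {q : G ⧸ H | Φ q.out ≠ 0}.Finite :=
  hΦ.finite.subset fun q hq => ⟨q.out, hq, QuotientGroup.out_eq' q⟩

theorem hasFiniteDoubleCosetSupport_conv [IsHeckePair H] {Φ Ψ : G → ℤ} (hΦ : IsBiinvariant H Φ)
    (hΨ : IsBiinvariant H Ψ) (hΦ' : HasFiniteDoubleCosetSupport H Φ)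
    (hΨ' : HasFiniteDoubleCosetSupport H Ψ) : HasFiniteDoubleCosetSupport H (conv H Φ Ψ) := by
  refine (isBiinvariant_conv hΦ hΨ).hasFiniteDoubleCosetSupport_of_finite ?_
  refine ((finite_out hΦ').biUnion fun q _ => hΨ'.finite.image fun r => q.out • r).subset ?_
  rintro _ ⟨g, hg, rfl⟩
  obtain ⟨q, h1, h2⟩ := exists_of_conv_ne_zero hg
  refine Set.mem_iUnion₂.mpr ⟨q, h1, _, ⟨_, h2, rfl⟩, ?_⟩
  change ((q.out * (q.out⁻¹ * g) : G) : G ⧸ H) = (g : G ⧸ H)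
  simp

theorem hasFiniteSupport_term [IsHeckePair H] {Φ : G → ℤ} (hΦ : HasFiniteDoubleCosetSupport H Φ)
    (f : G ⧸ H → ℤ) : (fun q : G ⧸ H => Φ q.out * f q).HasFiniteSupport :=
  (finite_out hΦ).subset fun q hq h0 => hq (by simp [h0])

theorem conv_assoc [IsHeckePair H] {Φ Ψ Χ : G → ℤ} (hΦ : IsBiinvariant H Φ)
    (hΨ : IsBiinvariant H Ψ) (hΧ : IsBiinvariant H Χ) (hΦ' : HasFiniteDoubleCosetSupport H Φ)
    (hΨ' : HasFiniteDoubleCosetSupport H Ψ) (g : G) :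
    conv H (conv H Φ Ψ) Χ g = conv H Φ (conv H Ψ Χ) g := by
  have hA := finite_out hΦ'
  have hB := finite_out (hasFiniteDoubleCosetSupport_conv hΦ hΨ hΦ' hΨ')
  have inner (q : G ⧸ H) : conv H Ψ Χ (q.out⁻¹ * g) =
      cosetSum H fun x => Ψ (q.out⁻¹ * x) * Χ (x⁻¹ * g) := by
    unfold conv
    rw [← cosetSum_mul_left (term_mul_right hΨ hΧ (q.out⁻¹ * g)) q.out⁻¹]
    congr 1
    funext x
    congr 2
    group
  have hfin (q : G ⧸ H) :
      (fun p : G ⧸ H => Ψ (q.out⁻¹ * p.out) * Χ (p.out⁻¹ * g)).HasFiniteSupport := by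
    refine (hΨ'.finite.image fun r => q.out • r).subset fun p hp => ?_
    refine ⟨_, ⟨q.out⁻¹ * p.out, left_ne_zero_of_mul hp, rfl⟩, ?_⟩
    change ((q.out * (q.out⁻¹ * p.out) : G) : G ⧸ H) = p
    rw [mul_inv_cancel_left]
    exact QuotientGroup.out_eq' p
  have rhs : conv H Φ (conv H Ψ Χ) g =
      ∑ q ∈ hA.toFinset, ∑ᶠ p : G ⧸ H, Φ q.out * (Ψ (q.out⁻¹ * p.out) * Χ (p.out⁻¹ * g)) := by
    rw [conv, cosetSum, finsum_eq_sum_of_support_subset (s := hA.toFinset)]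
    · refine Finset.sum_congr rfl fun q _ => ?_
      rw [inner, cosetSum, mul_finsum' _ _ (hfin q)]
    · intro q hq
      simpa using left_ne_zero_of_mul hq
  have lhs : conv H (conv H Φ Ψ) Χ g =
      ∑ᶠ p : G ⧸ H, ∑ q ∈ hA.toFinset, Φ q.out * (Ψ (q.out⁻¹ * p.out) * Χ (p.out⁻¹ * g)) := by
    rw [conv, cosetSum]
    refine finsum_congr fun p => ?_
    rw [conv, cosetSum, finsum_eq_sum_of_support_subset (s := hA.toFinset), Finset.sum_mul]
    · exact Finset.sum_congr rfl fun q _ => by ring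
    · intro q hq
      simpa using left_ne_zero_of_mul hq
  rw [lhs, rhs, finsum_sum_comm]
  intro q _
  exact (hfin q).subset fun p hp => right_ne_zero_of_mul hp

variable (H)

/-- `f_x`: the characteristic function of the double coset `HxH`. -/
noncomputable def char (x : G) : HeckeAlgebra H :=
  ⟨(doubleCoset x (H : Set G) (H : Set G)).indicator 1, by
    classical
    constructor
    · intro h hh k hk g
      have : h * g * k ∈ doubleCoset x (H : Set G) (H : Set G) ↔
          g ∈ doubleCoset x (H : Set G) (H : Set G) := by
        constructor
        · intro hm
          obtain ⟨a, ha, b, hb, hab⟩ := mem_doubleCoset.mp hm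
          refine mem_doubleCoset.mpr ⟨h⁻¹ * a, H.mul_mem (H.inv_mem hh) ha, b * k⁻¹,
            H.mul_mem hb (H.inv_mem hk), ?_⟩
          rw [show h⁻¹ * a * x * (b * k⁻¹) = h⁻¹ * (a * x * b) * k⁻¹ by group, ← hab]
          group
        · intro hm
          obtain ⟨a, ha, b, hb, rfl⟩ := mem_doubleCoset.mp hm
          exact mem_doubleCoset.mpr ⟨h * a, H.mul_mem hh ha, b * k, H.mul_mem hb hk, by group⟩
      simp only [Set.indicator_apply, this, Pi.one_apply]
    · refine ⟨{x}, ?_⟩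
      ext y
      simp⟩

theorem char_apply (x g : G) :
    char H x g = (doubleCoset x (H : Set G) (H : Set G)).indicator 1 g := rfl

theorem char_one_apply (g : G) : char H 1 g = (H : Set G).indicator 1 g := by
  have : doubleCoset (1 : G) (H : Set G) (H : Set G) = H := by
    ext y
    simp only [mem_doubleCoset, mul_one]
    constructor
    · rintro ⟨a, ha, b, hb, rfl⟩
      exact H.mul_mem ha hb
    · intro hy
      exact ⟨y, hy, 1, H.one_mem, by simp⟩
  rw [char_apply, this]

noncomputable instance : One (HeckeAlgebra H) := ⟨char H 1⟩

theorem one_apply (g : G) : (1 : HeckeAlgebra H) g = (H : Set G).indicator 1 g :=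
  char_one_apply H g

variable [IsHeckePair H]

noncomputable instance : Mul (HeckeAlgebra H) where
  mul Φ Ψ := ⟨conv H Φ Ψ, isBiinvariant_conv Φ.isBiinvariant Ψ.isBiinvariant,
    hasFiniteDoubleCosetSupport_conv Φ.isBiinvariant Ψ.isBiinvariant
      Φ.hasFiniteDoubleCosetSupport Ψ.hasFiniteDoubleCosetSupport⟩

variable {H}

theorem mul_apply (Φ Ψ : HeckeAlgebra H) (g : G) :
    (Φ * Ψ) g = ∑ᶠ q : G ⧸ H, Φ q.out * Ψ (q.out⁻¹ * g) := rfl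

/-- The Hecke algebra of a Hecke pair: the product is convolution and the identity element is the
characteristic function of `H`. -/
noncomputable instance : Ring (HeckeAlgebra H) :=
  { (inferInstance : AddCommGroup (HeckeAlgebra H)),
    (inferInstance : Mul (HeckeAlgebra H)), (inferInstance : One (HeckeAlgebra H)) with
    left_distrib := fun a b c => by
      ext g
      simp only [mul_apply, add_apply, mul_add]
      exact finsum_add_distrib (hasFiniteSupport_term a.hasFiniteDoubleCosetSupport _)
        (hasFiniteSupport_term a.hasFiniteDoubleCosetSupport _)
    right_distrib := fun a b c => by
      ext g
      simp only [mul_apply, add_apply, add_mul]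
      exact finsum_add_distrib (hasFiniteSupport_term a.hasFiniteDoubleCosetSupport _)
        (hasFiniteSupport_term b.hasFiniteDoubleCosetSupport _)
    zero_mul := fun a => by ext g; simp [mul_apply]
    mul_zero := fun a => by ext g; simp [mul_apply]
    mul_assoc := fun a b c => by
      ext g
      exact conv_assoc a.isBiinvariant b.isBiinvariant c.isBiinvariant
        a.hasFiniteDoubleCosetSupport b.hasFiniteDoubleCosetSupport g
    one_mul := fun a => by
      ext g
      refine (cosetSum_single (H := H)
        (f := fun x => (1 : HeckeAlgebra H) x * a (x⁻¹ * g)) (term_mul_right (1 : HeckeAlgebra H).isBiinvariant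
        a.isBiinvariant g) (1 : G) ?_).trans ?_
      · intro x hx
        have := left_ne_zero_of_mul hx
        rw [one_apply] at this
        simpa using Set.mem_of_indicator_ne_zero this
      · simp [one_apply, H.one_mem]
    mul_one := fun a => by
      ext g
      refine (cosetSum_single (H := H)
        (f := fun x => a x * (1 : HeckeAlgebra H) (x⁻¹ * g)) (term_mul_right a.isBiinvariant
        (1 : HeckeAlgebra H).isBiinvariant g) g ?_).trans ?_
      · intro x hx
        have := right_ne_zero_of_mul hx
        rw [one_apply] at this
        have hm : x⁻¹ * g ∈ H := Set.mem_of_indicator_ne_zero this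
        simpa using H.inv_mem hm
      · simp [one_apply, H.one_mem]
    zsmul := fun n a => n • a
    zsmul_zero' := fun a => zero_smul ℤ a
    zsmul_succ' := fun n a => SubNegMonoid.zsmul_succ' n a
    zsmul_neg' := fun n a => SubNegMonoid.zsmul_neg' n a }

/-- For a subgroup `K` with `H ≤ K`, the subalgebra `ℋ(K, H)` of `ℋ(G, H)`: the functions on `K`
are extended by zero to `G`, so it consists of the functions supported in `K`. -/
noncomputable def supportedIn (K : Subgroup G) (hHK : H ≤ K) : Subalgebra ℤ (HeckeAlgebra H) where
  carrier := {Φ | ∀ g, g ∉ K → Φ g = 0}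
  mul_mem' := by
    intro Φ Ψ hΦ hΨ g hg
    by_contra hne
    obtain ⟨q, h1, h2⟩ := exists_of_conv_ne_zero hne
    have h1' : q.out ∈ K := by
      by_contra h
      exact h1 (hΦ _ h)
    have h2' : q.out⁻¹ * g ∈ K := by
      by_contra h
      exact h2 (hΨ _ h)
    exact hg (by simpa using K.mul_mem h1' h2')
  add_mem' := by
    intro Φ Ψ hΦ hΨ g hg
    rw [add_apply, hΦ g hg, hΨ g hg, add_zero]
  algebraMap_mem' := by
    intro n g hg
    have h1 : (1 : HeckeAlgebra H) g = 0 := by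
      rw [one_apply]
      exact Set.indicator_of_notMem (fun h => hg (hHK h)) _
    have hz : ∀ n : ℤ, (n • (1 : HeckeAlgebra H)) g = n * (1 : HeckeAlgebra H) g :=
      fun n => by
        change ((n • ((1 : HeckeAlgebra H) : G → ℤ)) g) = _
        simp
    rw [algebraMap_int_eq, eq_intCast, ← zsmul_one, hz, h1, mul_zero]

end HeckeAlgebra

end HeckeAlgebra

namespace GLHecke

open Polynomial ValuativeRel DoubleCoset

section
variable (F : Type*) {D : Type*} [Field F] [DivisionRing D] [Algebra F D] [FiniteDimensional F D]

theorem exists_norm_eq_coeff_zero_minpoly_pow (x : D) :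
    ∃ n : ℕ, n ≠ 0 ∧ Algebra.norm F x =
      ((-1) ^ (minpoly F x).natDegree * (minpoly F x).coeff 0) ^ n := by
  have hx : IsIntegral F x := Algebra.IsIntegral.isIntegral x
  have hirr : Fact (Irreducible (minpoly F x)) := ⟨minpoly.irreducible hx⟩
  have hmon := minpoly.monic hx
  let φ : AdjoinRoot (minpoly F x) →+* D :=
    Ideal.Quotient.lift _ (aeval x : F[X] →ₐ[F] D).toRingHom (by
      intro a ha
      obtain ⟨b, rfl⟩ := Ideal.mem_span_singleton.mp ha
      simp [minpoly.aeval])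
  have hφx : φ (AdjoinRoot.root (minpoly F x)) = x := by
    change φ (AdjoinRoot.mk _ X) = x
    change aeval x X = x
    simp
  have hφF (a : F) : φ (algebraMap F _ a) = algebraMap F D a := by
    change aeval x (C a) = _
    simp
  let : Module (AdjoinRoot (minpoly F x)) D := Module.compHom D φ
  have hsmul (l : AdjoinRoot (minpoly F x)) (d : D) : l • d = φ l * d := rfl
  have : IsScalarTower F (AdjoinRoot (minpoly F x)) D := ⟨fun a l d ↦ by
    rw [hsmul, hsmul, Algebra.smul_def a l, map_mul, hφF, Algebra.smul_def, mul_assoc]⟩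
  have : Module.Finite (AdjoinRoot (minpoly F x)) D :=
    Module.Finite.of_restrictScalars_finite F _ _
  refine ⟨Module.finrank (AdjoinRoot (minpoly F x)) D, Module.finrank_pos.ne', ?_⟩
  have key : Algebra.lmul F D x =
      ((AdjoinRoot.root (minpoly F x)) •
        (LinearMap.id : D →ₗ[AdjoinRoot (minpoly F x)] D)).restrictScalars F := by
    ext d
    simp [hsmul, hφx]
  have hpb := Algebra.PowerBasis.norm_gen_eq_coeff_zero_minpoly (AdjoinRoot.powerBasis' hmon)
  rw [Algebra.norm_apply, key, LinearMap.det_restrictScalars, LinearMap.det_smul,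
    LinearMap.det_id, mul_one, map_pow]
  congr 1
  rw [AdjoinRoot.powerBasis'_gen, AdjoinRoot.powerBasis'_dim] at hpb
  rw [hpb, AdjoinRoot.minpoly_root hmon.ne_zero]
  simp [hmon.leadingCoeff]

end

section
theorem coeff_le_one_of_irreducible_normed {K : Type*} [NontriviallyNormedField K] [CompleteSpace K]
    [IsUltrametricDist K] {p : K[X]} (hm : p.Monic) (hp : Irreducible p) (h0 : ‖p.coeff 0‖ ≤ 1)
    (n : ℕ) : ‖p.coeff n‖ ≤ 1 := by
  have : Fact (Irreducible p) := ⟨hp⟩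
  have hmin : minpoly K (AdjoinRoot.root p) = p := by
    rw [AdjoinRoot.minpoly_root hm.ne_zero]
    simp [hm.leadingCoeff]
  have : FiniteDimensional K (AdjoinRoot p) := (AdjoinRoot.powerBasis' hm).finite
  have h := spectralNorm.spectralNorm_eq_norm_coeff_zero_rpow K (AdjoinRoot p) (AdjoinRoot.root p)
  rw [spectralNorm, hmin] at h
  refine (spectralValue_le_one_iff hm).mp ?_ n
  rw [h]
  exact Real.rpow_le_one (norm_nonneg _) h0 (by positivity)

theorem coeff_le_one_of_irreducible {F : Type*} [Field F] [ValuativeRel F] [TopologicalSpace F]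
    [IsNonarchimedeanLocalField F] {p : F[X]} (hm : p.Monic) (hp : Irreducible p)
    (h0 : valuation F (p.coeff 0) ≤ 1) (n : ℕ) : valuation F (p.coeff n) ≤ 1 := by
  let := IsTopologicalAddGroup.rightUniformSpace F
  have := isUniformAddGroup_of_addCommGroup (G := F)
  let : (Valued.v (R := F) (Γ₀ := ValueGroupWithZero F)).RankOne :=
  { hom' := IsRankLeOne.nonempty.some.emb (R := F).comp MonoidWithZeroHom.ValueGroup₀.embedding
    strictMono' := IsRankLeOne.nonempty.some.strictMono.comp
        MonoidWithZeroHom.ValueGroup₀.embedding_strictMono }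
  let : NontriviallyNormedField F := Valued.toNontriviallyNormedField F (ValueGroupWithZero F)
  have key (x : F) : ‖x‖ ≤ 1 ↔ valuation F x ≤ 1 :=
    Valued.toNormedField.norm_le_one_iff (L := F) (Γ₀ := ValueGroupWithZero F)
  rw [← key] at h0 ⊢
  exact coeff_le_one_of_irreducible_normed hm hp h0 n
end

section DivisionAlgebra

variable (F : Type*) [Field F] [ValuativeRel F] [TopologicalSpace F] [IsNonarchimedeanLocalField F]
variable (D : Type*) [DivisionRing D] [Algebra F D] [FiniteDimensional F D]

variable {D} in
theorem valuation_norm_le_one_iff (x : D) :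
    valuation F (Algebra.norm F x) ≤ 1 ↔ valuation F ((minpoly F x).coeff 0) ≤ 1 := by
  obtain ⟨n, hn, h⟩ := exists_norm_eq_coeff_zero_minpoly_pow F x
  rw [h, map_pow, map_mul, map_pow, Valuation.map_neg, map_one, one_pow, one_mul,
    pow_le_one_iff hn]

variable {D} in
theorem valuation_norm_add_one_le {x : D} (hx : valuation F (Algebra.norm F x) ≤ 1) :
    valuation F (Algebra.norm F (x + 1)) ≤ 1 := by
  have hint : IsIntegral F x := Algebra.IsIntegral.isIntegral x
  have hcoeff := coeff_le_one_of_irreducible (minpoly.monic hint) (minpoly.irreducible hint)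
    ((valuation_norm_le_one_iff F x).mp hx)
  have hmin : minpoly F (x + 1) = (minpoly F x).comp (X - C 1) := by
    have h1 : (minpoly F x).comp (X - C 1) = algEquivAevalXAddC (-1 : F) (minpoly F x) := by
      rw [algEquivAevalXAddC_apply, ← comp_eq_aeval, C_neg, sub_eq_add_neg]
    refine (minpoly.eq_of_irreducible_of_monic ?_ ?_ ?_).symm
    · rw [h1]
      exact (MulEquiv.irreducible_iff (algEquivAevalXAddC (-1 : F))).mpr (minpoly.irreducible hint)
    · rw [aeval_comp]
      simp [minpoly.aeval]
    · exact (minpoly.monic hint).comp_X_sub_C 1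
  rw [valuation_norm_le_one_iff, hmin]
  rw [coeff_zero_eq_eval_zero, eval_comp, eval_sub, eval_X, eval_C, zero_sub, eval_eq_sum]
  refine Valuation.map_sum_le _ fun i _ => ?_
  rw [map_mul, map_pow, Valuation.map_neg, map_one, one_pow, mul_one]
  exact hcoeff i

/-- The valuation `x ↦ v(N_{D/F}(x))` on the division algebra `D`, where `v` is the valuation of the
local field `F` and `N_{D/F}(x)` is the determinant of left multiplication by `x` on the `F`-vector
space `D`. -/
noncomputable def normValuation : Valuation D (ValueGroupWithZero F) where
  toFun x := valuation F (Algebra.norm F x)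
  map_zero' := by rw [Algebra.norm_zero, map_zero]
  map_one' := by rw [map_one, map_one]
  map_mul' x y := by rw [map_mul, map_mul]
  map_add_le_max' := by
    have main : ∀ x y : D, valuation F (Algebra.norm F x) ≤ valuation F (Algebra.norm F y) →
        valuation F (Algebra.norm F (x + y)) ≤ valuation F (Algebra.norm F y) := by
      intro x y hxy
      by_cases hy : y = 0
      · subst hy
        rw [Algebra.norm_zero, map_zero, le_zero_iff, map_eq_zero, Algebra.norm_eq_zero_iff] at hxy
        rw [hxy, add_zero]
      · have hy' : valuation F (Algebra.norm F y) ≠ 0 := by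
          rwa [ne_eq, map_eq_zero, Algebra.norm_eq_zero_iff]
        have h1 : valuation F (Algebra.norm F (x * y⁻¹)) ≤ 1 := by
          rw [map_mul, map_mul, Algebra.norm_inv, map_inv₀]
          exact mul_inv_le_one_of_le₀ hxy zero_le
        have h2 := valuation_norm_add_one_le F h1
        have h3 : x + y = (x * y⁻¹ + 1) * y := by
          rw [add_mul, mul_assoc, inv_mul_cancel₀ hy, mul_one, one_mul]
        rw [h3, map_mul, map_mul]
        exact mul_le_of_le_one_left' h2
    intro x y
    rcases le_total (valuation F (Algebra.norm F x)) (valuation F (Algebra.norm F y)) with h | h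
    · exact (main x y h).trans (le_max_right _ _)
    · rw [add_comm]
      exact (main y x h).trans (le_max_left _ _)

variable {D} in
theorem normValuation_apply (x : D) :
    normValuation F D x = valuation F (Algebra.norm F x) := rfl

/-- The ring of integers `𝒪_D = {x ∈ D | v(N_{D/F}(x)) ≤ 1}` of `D`. -/
noncomputable def integerRing : Subring D := (normValuation F D).integer

variable {D} in
theorem mem_integerRing {x : D} : x ∈ integerRing F D ↔ normValuation F D x ≤ 1 := Iff.rfl

/-- The maximal ideal `℘_D = {x ∈ D | v(N_{D/F}(x)) < 1}` of `𝒪_D`. -/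
noncomputable def primeIdeal : Ideal (integerRing F D) where
  carrier := {x | normValuation F D (x : D) < 1}
  zero_mem' := by simp
  add_mem' := fun {a b} ha hb => by
    change normValuation F D ((a : D) + (b : D)) < 1
    exact (Valuation.map_add _ _ _).trans_lt (max_lt ha hb)
  smul_mem' := fun c {x} hx => by
    change normValuation F D ((c : D) * (x : D)) < 1
    rw [map_mul]
    exact (mul_le_of_le_one_left' c.2).trans_lt hx

variable {D} in
theorem mem_primeIdeal {x : integerRing F D} :
    x ∈ primeIdeal F D ↔ normValuation F D (x : D) < 1 := Iff.rfl

instance : (primeIdeal F D).IsTwoSided where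
  mul_mem_of_left := fun {a} b ha => by
    rw [mem_primeIdeal] at ha ⊢
    change normValuation F D ((a : D) * (b : D)) < 1
    rw [map_mul]
    exact (mul_le_of_le_one_right' b.2).trans_lt ha

/-- The residue ring `𝔨_D = 𝒪_D / ℘_D`. -/
abbrev ResidueRing : Type _ := integerRing F D ⧸ primeIdeal F D

variable {D} in
/-- `ϖ` is a uniformizer of `𝒪_D`: `℘_D = ϖ 𝒪_D`. -/
def IsUniformizer (ϖ : D) : Prop :=
  ∀ x : D, normValuation F D x < 1 ↔ ∃ y ∈ integerRing F D, x = ϖ * y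

/-- `σ` is a multiplicative section of the reduction map `𝒪_D^× → 𝔨_D^×`. -/
def IsMultiplicativeSection (σ : (ResidueRing F D)ˣ →* (integerRing F D)ˣ) : Prop :=
  ∀ a, Units.map (Ideal.Quotient.mk (primeIdeal F D) : integerRing F D →* ResidueRing F D) (σ a) = a

end DivisionAlgebra

section GeneralLinearGroup

open Matrix

variable (F : Type*) [Field F] [ValuativeRel F] [TopologicalSpace F] [IsNonarchimedeanLocalField F]
variable (D : Type*) [DivisionRing D] [Algebra F D] [FiniteDimensional F D] (m : ℕ)

/-- `K = GL_m(𝒪_D)`: the matrices of `GL_m(D)` which, together with their inverse, have entries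
in `𝒪_D`. -/
def maxCompact : Subgroup (GL (Fin m) D) where
  carrier := {g | (∀ i j, (g : Matrix (Fin m) (Fin m) D) i j ∈ integerRing F D) ∧
    ∀ i j, ((g⁻¹ : GL (Fin m) D) : Matrix (Fin m) (Fin m) D) i j ∈ integerRing F D}
  one_mem' := by
    have h : ∀ i j, (1 : Matrix (Fin m) (Fin m) D) i j ∈ integerRing F D := fun i j => by
      rw [one_apply]
      split_ifs
      · exact one_mem _
      · exact zero_mem _
    exact ⟨h, by simpa using h⟩
  mul_mem' := by
    rintro a b ⟨ha, ha'⟩ ⟨hb, hb'⟩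
    refine ⟨fun i j => ?_, fun i j => ?_⟩
    · rw [Units.val_mul, mul_apply]
      exact sum_mem fun k _ => mul_mem (ha i k) (hb k j)
    · rw [_root_.mul_inv_rev, Units.val_mul, mul_apply]
      exact sum_mem fun k _ => mul_mem (hb' i k) (ha' k j)
  inv_mem' := by
    rintro a ⟨ha, ha'⟩
    exact ⟨ha', by simpa using ha⟩

/-- `K¹ = 𝕀_m + M_m(℘_D)`: the matrices of `K` that are congruent to `𝕀_m` modulo `℘_D`. -/
def proRadical : Subgroup (GL (Fin m) D) where
  carrier := {g | g ∈ maxCompact F D m ∧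
    ∀ i j, normValuation F D (((g : Matrix (Fin m) (Fin m) D) - 1) i j) < 1}
  one_mem' := ⟨one_mem _, by simp⟩
  mul_mem' := by
    rintro a b ⟨ha, ha'⟩ ⟨hb, hb'⟩
    refine ⟨mul_mem ha hb, fun i j => ?_⟩
    have : (((a * b : GL (Fin m) D) : Matrix (Fin m) (Fin m) D) - 1) =
        (a : Matrix (Fin m) (Fin m) D) * ((b : Matrix (Fin m) (Fin m) D) - 1) +
          ((a : Matrix (Fin m) (Fin m) D) - 1) := by
      rw [Units.val_mul]
      noncomm_ring
    rw [this, Matrix.add_apply, mul_apply]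
    refine (Valuation.map_add _ _ _).trans_lt (max_lt ?_ (ha' i j))
    refine Valuation.map_sum_lt _ one_ne_zero fun k _ => ?_
    rw [map_mul]
    exact (mul_le_of_le_one_left' (ha.1 i k)).trans_lt (hb' k j)
  inv_mem' := by
    rintro a ⟨ha, ha'⟩
    refine ⟨inv_mem ha, fun i j => ?_⟩
    have : ((a⁻¹ : GL (Fin m) D) : Matrix (Fin m) (Fin m) D) - 1 =
        -(((a⁻¹ : GL (Fin m) D) : Matrix (Fin m) (Fin m) D) *
          ((a : Matrix (Fin m) (Fin m) D) - 1)) := by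
      rw [mul_sub, mul_one, Units.inv_mul, neg_sub]
    rw [this, Matrix.neg_apply, Valuation.map_neg, mul_apply]
    refine Valuation.map_sum_lt _ one_ne_zero fun k _ => ?_
    rw [map_mul]
    exact (mul_le_of_le_one_left' (ha.2 i k)).trans_lt (ha' k j)

theorem proRadical_le_maxCompact : proRadical F D m ≤ maxCompact F D m := fun _ h => h.1

variable {D m}

/-- The diagonal matrix `diag(d₁, …, d_m)` of `GL_m(D)`. -/
def diagonalGL (d : Fin m → Dˣ) : GL (Fin m) D where
  val := diagonal fun i => (d i : D)
  inv := diagonal fun i => ((d i)⁻¹ : Dˣ)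
  val_inv := by simp
  inv_val := by simp

/-- `τ_i`, the diagonal matrix with `i` entries `1` followed by `m - i` entries `ϖ`. -/
def tau (m : ℕ) (ϖ : Dˣ) (i : ℕ) : GL (Fin m) D :=
  diagonalGL fun j => if (j : ℕ) < i then 1 else ϖ

/-- The permutation matrix `s_α` of the transposition exchanging `i` and `i + 1`, for the simple root
`α = α_{i,i+1}`. With rows and columns numbered from `0`, the simple roots are the pairs
`(a, a + 1)` with `a : Fin (m - 1)`. -/
def simpleReflection (D : Type*) [DivisionRing D] {m : ℕ} (a : Fin (m - 1)) : GL (Fin m) D where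
  val := swap D ⟨a, by omega⟩ ⟨a + 1, by omega⟩
  inv := swap D ⟨a, by omega⟩ ⟨a + 1, by omega⟩
  val_inv := swap_mul_self _ _
  inv_val := swap_mul_self _ _

variable (D m)

/-- `Ω = K ∪ {τ_0, τ_0⁻¹} ∪ {τ_α | α simple}`; the simple root `(a, a + 1)`, numbered from `0`,
corresponds to `τ_{a + 1}`. -/
def generatorSet (ϖ : Dˣ) : Set (GL (Fin m) D) :=
  (maxCompact F D m : Set (GL (Fin m) D)) ∪ {tau m ϖ 0, (tau m ϖ 0)⁻¹} ∪
    Set.range fun a : Fin (m - 1) => tau m ϖ (a + 1)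

/-- `U`: the upper unipotent matrices of `K`. -/
def upperUnipotent : Set (GL (Fin m) D) :=
  {g | g ∈ maxCompact F D m ∧ (∀ i, (g : Matrix (Fin m) (Fin m) D) i i = 1) ∧
    ∀ i j, j < i → (g : Matrix (Fin m) (Fin m) D) i j = 0}

variable {D} in
/-- `T`: the diagonal matrices with entries in the image of the section `σ : 𝔨_D^× → 𝒪_D^×`. -/
def diagonalTorus (σ : (ResidueRing F D)ˣ →* (integerRing F D)ˣ) : Set (GL (Fin m) D) :=
  Set.range fun a : Fin m → (ResidueRing F D)ˣ =>
    diagonalGL fun i => Units.map ((integerRing F D).subtype : integerRing F D →* D) (σ (a i))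

end GeneralLinearGroup

section Finiteness

theorem valuation_lt_one_iff_mem_maximalIdeal {F : Type*} [Field F] [ValuativeRel F]
    [TopologicalSpace F] [IsNonarchimedeanLocalField F] (a : 𝒪[F]) :
    valuation F (a : F) < 1 ↔ a ∈ 𝓂[F] := by
  rw [IsLocalRing.mem_maximalIdeal, mem_nonunits_iff,
    (Valuation.integer.integers (valuation F)).isUnit_iff_valuation_eq_one]
  exact a.2.lt_iff_ne

variable (F : Type*) [Field F] [ValuativeRel F] [TopologicalSpace F] [IsNonarchimedeanLocalField F]
variable (D : Type*) [DivisionRing D] [Algebra F D] [FiniteDimensional F D]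

variable {D} in
theorem normValuation_smul (a : F) (x : D) :
    normValuation F D (a • x) = valuation F a ^ Module.finrank F D * normValuation F D x := by
  rw [Algebra.smul_def, map_mul, normValuation_apply F (algebraMap F D a), Algebra.norm_algebraMap,
    map_pow]

/-- `𝒪_D` as a module over the ring of integers of `F`. -/
noncomputable def integerModule : Submodule 𝒪[F] D where
  carrier := {x | normValuation F D x ≤ 1}
  zero_mem' := by simp
  add_mem' := fun {a b} ha hb => by
    change normValuation F D (a + b) ≤ 1
    exact (Valuation.map_add _ _ _).trans (max_le ha hb)
  smul_mem' := fun a x hx => by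
    change normValuation F D ((a : F) • x) ≤ 1
    rw [normValuation_smul]
    exact mul_le_one' (pow_le_one' a.2 _) hx

theorem exists_finite_mod_uniformizer {π : F} (hπ : ∀ a : F, valuation F a < 1 →
    valuation F a ≤ valuation F π) : ∃ R : Set D, R.Finite ∧ ∀ x : D, normValuation F D x ≤ 1 →
      ∃ r ∈ R, normValuation F D r ≤ 1 ∧
        normValuation F D (x - r) ≤ valuation F π ^ Module.finrank F D := by
  classical
  let M := integerModule F D
  let N : Submodule 𝒪[F] M := 𝓂[F] • ⊤
  let k := 𝒪[F] ⧸ 𝓂[F]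
  let : Field k := Ideal.Quotient.field 𝓂[F]
  let : Module k (M ⧸ N) :=
    inferInstanceAs (Module (𝒪[F] ⧸ 𝓂[F]) (M ⧸ (𝓂[F] • ⊤ : Submodule 𝒪[F] M)))
  have : Finite k := inferInstanceAs (Finite 𝓀[F])
  have hM : ∀ y : M, normValuation F D (y : D) ≤ 1 := fun y => y.2
  have hN : ∀ y ∈ N, normValuation F D (y : D) ≤ valuation F π ^ Module.finrank F D := by
    intro y hy
    refine Submodule.smul_induction_on hy ?_ ?_
    · intro a ha z _
      change normValuation F D ((a : F) • (z : D)) ≤ _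
      rw [normValuation_smul]
      refine (mul_le_of_le_one_right' (hM z)).trans (pow_le_pow_left' (hπ _ ?_) _)
      exact (valuation_lt_one_iff_mem_maximalIdeal a).mpr ha
    · intro a b ha hb
      exact (Valuation.map_add _ _ _).trans (max_le ha hb)
  have hrank : Module.rank k (M ⧸ N) ≤ (Module.finrank F D : ℕ) := by
    refine rank_le fun s hs => ?_
    let x : s → D := fun i => ((Submodule.Quotient.mk_surjective N (i : M ⧸ N)).choose : M)
    have hli : LinearIndependent F x := by
      rw [linearIndependent_iff']
      intro t c hc
      by_contra! hne
      obtain ⟨i₀, hi₀, hci₀⟩ := hne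
      obtain ⟨j, hj, hjmax⟩ := t.exists_max_image (fun i => valuation F (c i)) ⟨i₀, hi₀⟩
      have hcj : c j ≠ 0 := by
        intro h0
        have := hjmax i₀ hi₀
        rw [h0, map_zero, le_zero_iff, map_eq_zero] at this
        exact hci₀ this
      have hle : ∀ i ∈ t, valuation F (c i / c j) ≤ 1 := fun i hi => by
        rw [map_div₀]
        exact div_le_one_of_le₀ (hjmax i hi) zero_le
      let b : s → 𝒪[F] := fun i => if h : i ∈ t then ⟨c i / c j, hle i h⟩ else 0
      have hb : ∀ i ∈ t, (b i : F) = c i / c j := fun i hi => by simp [b, hi]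
      let y : s → M := fun i => (Submodule.Quotient.mk_surjective N (i : M ⧸ N)).choose
      have hy : ∀ i, Submodule.Quotient.mk (p := N) (y i) = (i : M ⧸ N) := fun i =>
        (Submodule.Quotient.mk_surjective N (i : M ⧸ N)).choose_spec
      have hsum : ∑ i ∈ t, b i • y i = 0 := by
        apply Subtype.ext
        rw [AddSubmonoidClass.coe_finsetSum]
        change ∑ i ∈ t, (b i : F) • x i = 0
        rw [Finset.sum_congr rfl fun i hi => by rw [hb i hi, div_eq_inv_mul, mul_smul],
          ← Finset.smul_sum, hc, smul_zero]
      have hsum' : ∑ i ∈ t, (Ideal.Quotient.mk 𝓂[F] (b i) : k) • (i : M ⧸ N) = 0 := by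
        have := congrArg N.mkQ hsum
        rw [map_sum, map_zero] at this
        rw [← this]
        refine Finset.sum_congr rfl fun i _ => ?_
        rw [map_smul, Submodule.mkQ_apply, hy]
        rfl
      have h0 := (linearIndependent_iff'.mp hs) t _ hsum' j hj
      have h1 : b j = 1 := by
        apply Subtype.ext
        rw [hb j hj, div_self hcj]
        rfl
      rw [h1, map_one] at h0
      exact one_ne_zero h0
    simpa using hli.fintype_card_le_finrank
  have : Module.Finite k (M ⧸ N) := by
    rw [← Module.rank_lt_aleph0_iff]
    exact hrank.trans_lt (Cardinal.natCast_lt_aleph0)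
  have : Finite (M ⧸ N) := Module.finite_of_finite k
  refine ⟨Set.range fun q : M ⧸ N => ((Submodule.Quotient.mk_surjective N q).choose : D),
    Set.finite_range _, fun x hx => ?_⟩
  let x' : M := ⟨x, show x ∈ integerModule F D from hx⟩
  refine ⟨_, ⟨Submodule.Quotient.mk x', rfl⟩, hM _, ?_⟩
  have h := (Submodule.Quotient.mk_surjective N (Submodule.Quotient.mk x')).choose_spec
  exact hN _ ((Submodule.Quotient.eq N).mp h.symm)

theorem exists_finite_mod_pow {π : F} (hπ0 : π ≠ 0) (hπ : ∀ a : F, valuation F a < 1 →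
    valuation F a ≤ valuation F π) (n : ℕ) : ∃ R : Set D, R.Finite ∧
      ∀ x : D, normValuation F D x ≤ 1 → ∃ r ∈ R,
        normValuation F D (x - r) ≤ (valuation F π ^ Module.finrank F D) ^ n := by
  obtain ⟨R, hR, hR'⟩ := exists_finite_mod_uniformizer F D hπ
  induction n with
  | zero => exact ⟨{0}, Set.finite_singleton 0, fun x hx => ⟨0, rfl, by simpa using hx⟩⟩
  | succ n ih =>
    obtain ⟨S, hS, hS'⟩ := ih
    refine ⟨Set.image2 (fun s r => s + π ^ n • r) S R, hS.image2 _ hR, fun x hx => ?_⟩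
    obtain ⟨s, hs, hxs⟩ := hS' x hx
    have hv : valuation F π ≠ 0 := by simpa using hπ0
    have hy : normValuation F D ((π ^ n)⁻¹ • (x - s)) ≤ 1 := by
      rw [normValuation_smul, map_inv₀, map_pow, inv_pow, ← pow_mul, mul_comm n, pow_mul]
      exact inv_mul_le_one_of_le₀ hxs zero_le
    obtain ⟨r, hr, _, hyr⟩ := hR' _ hy
    refine ⟨_, ⟨s, hs, r, hr, rfl⟩, ?_⟩
    have : x - (s + π ^ n • r) = π ^ n • ((π ^ n)⁻¹ • (x - s) - r) := by
      rw [smul_sub, smul_inv_smul₀ (pow_ne_zero n hπ0)]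
      abel
    rw [this, normValuation_smul, map_pow, ← pow_mul, mul_comm n, pow_mul, pow_succ]
    exact mul_le_mul_right hyr _

theorem exists_uniformizer : ∃ π : F, π ≠ 0 ∧ valuation F π < 1 ∧
    ∀ a : F, valuation F a < 1 → valuation F a ≤ valuation F π := by
  obtain ⟨ϖ, hϖ⟩ := IsDiscreteValuationRing.exists_irreducible 𝒪[F]
  have hmax := hϖ.maximalIdeal_eq
  refine ⟨ϖ, ?_, ?_, ?_⟩
  · simpa using hϖ.ne_zero
  · exact (valuation_lt_one_iff_mem_maximalIdeal ϖ).mpr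
      (hmax ▸ Ideal.mem_span_singleton_self ϖ)
  · intro a ha
    have h : (⟨a, ha.le⟩ : 𝒪[F]) ∈ 𝓂[F] :=
      (valuation_lt_one_iff_mem_maximalIdeal _).mp ha
    rw [hmax] at h
    obtain ⟨b, hb⟩ := Ideal.mem_span_singleton.mp h
    have hb' : a = ϖ * b := congrArg Subtype.val hb
    rw [hb', map_mul]
    exact mul_le_of_le_one_right' b.2

end Finiteness

section HeckePairInstance

open Matrix

variable (F : Type*) [Field F] [ValuativeRel F] [TopologicalSpace F] [IsNonarchimedeanLocalField F]
variable (D : Type*) [DivisionRing D] [Algebra F D] [FiniteDimensional F D] (m : ℕ)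

variable {D m} in
theorem exists_entry_bound (A : Matrix (Fin m) (Fin m) D) :
    ∃ B : (ValueGroupWithZero F)ˣ, ∀ i j, normValuation F D (A i j) ≤ B := by
  classical
  let s : Finset (ValueGroupWithZero F) :=
    insert 1 (Finset.univ.image fun p : Fin m × Fin m => normValuation F D (A p.1 p.2))
  have hs : s.Nonempty := ⟨1, by simp [s]⟩
  have h1 : 1 ≤ s.max' hs := s.le_max' _ (by simp [s])
  refine ⟨Units.mk0 (s.max' hs) (zero_lt_one.trans_le h1).ne', fun i j => ?_⟩
  exact s.le_max' _ (by
    refine Finset.mem_insert_of_mem (Finset.mem_image.mpr ⟨(i, j), Finset.mem_univ _, rfl⟩))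

variable {D m} in
theorem inv_mul_mem_proRadical {g k k' : GL (Fin m) D} {B B' : (ValueGroupWithZero F)ˣ}
    {c : ValueGroupWithZero F} (hc : (B' : ValueGroupWithZero F) * c * B < 1)
    (hB : ∀ i j, normValuation F D ((g : Matrix (Fin m) (Fin m) D) i j) ≤ B)
    (hB' : ∀ i j, normValuation F D (((g⁻¹ : GL (Fin m) D) : Matrix (Fin m) (Fin m) D) i j) ≤ B')
    (hk : k ∈ proRadical F D m) (hk' : k' ∈ proRadical F D m)
    (h : ∀ i j, normValuation F D
      (((k' : Matrix (Fin m) (Fin m) D) - (k : Matrix (Fin m) (Fin m) D)) i j) ≤ c) :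
    (k * g)⁻¹ * (k' * g) ∈ proRadical F D m := by
  have main : ∀ k k' : GL (Fin m) D, k ∈ proRadical F D m →
      (∀ i j, normValuation F D
        (((k' : Matrix (Fin m) (Fin m) D) - (k : Matrix (Fin m) (Fin m) D)) i j) ≤ c) →
      ∀ i j, normValuation F D
        (((((k * g)⁻¹ * (k' * g) : GL (Fin m) D) : Matrix (Fin m) (Fin m) D) - 1) i j) < 1 := by
    intro k k' hk h i j
    have e : (((k * g)⁻¹ * (k' * g) : GL (Fin m) D) : Matrix (Fin m) (Fin m) D) - 1 =
        ((g⁻¹ : GL (Fin m) D) : Matrix (Fin m) (Fin m) D) *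
          ((((k⁻¹ : GL (Fin m) D) : Matrix (Fin m) (Fin m) D) *
            ((k' : Matrix (Fin m) (Fin m) D) - (k : Matrix (Fin m) (Fin m) D))) *
              (g : Matrix (Fin m) (Fin m) D)) := by
      rw [mul_sub, Units.inv_mul, sub_mul, one_mul, mul_sub, Units.inv_mul, _root_.mul_inv_rev]
      simp only [Units.val_mul, mul_assoc]
    rw [e, mul_apply]
    refine Valuation.map_sum_lt _ one_ne_zero fun a _ => ?_
    rw [map_mul]
    refine lt_of_le_of_lt ?_ hc
    rw [mul_assoc (B' : ValueGroupWithZero F)]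
    refine mul_le_mul' (hB' i a) ?_
    rw [mul_apply]
    refine Valuation.map_sum_le _ fun b _ => ?_
    rw [map_mul]
    refine mul_le_mul' ?_ (hB b j)
    rw [mul_apply]
    refine Valuation.map_sum_le _ fun d _ => ?_
    rw [map_mul]
    exact (mul_le_of_le_one_left' (hk.1.2 a d)).trans (h d b)
  have integral : ∀ x : GL (Fin m) D,
      (∀ i j, normValuation F D (((x : Matrix (Fin m) (Fin m) D) - 1) i j) < 1) →
      ∀ i j, (x : Matrix (Fin m) (Fin m) D) i j ∈ integerRing F D := by
    intro x hx i j
    have e : (x : Matrix (Fin m) (Fin m) D) i j =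
        ((x : Matrix (Fin m) (Fin m) D) - 1) i j + (1 : Matrix (Fin m) (Fin m) D) i j := by
      rw [Matrix.sub_apply, sub_add_cancel]
    rw [e]
    refine add_mem (hx i j).le ?_
    rw [one_apply]
    split_ifs
    · exact one_mem _
    · exact zero_mem _
  have h1 := main k k' hk h
  have h2 := main k' k hk' fun i j => by
    rw [← neg_sub, Matrix.neg_apply, Valuation.map_neg]
    exact h i j
  refine ⟨⟨integral _ h1, ?_⟩, h1⟩
  have e : ((k * g)⁻¹ * (k' * g))⁻¹ = (k' * g)⁻¹ * (k * g) := by group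
  rw [e]
  exact integral _ h2

/-- `(GL_m(D), K¹)` is a Hecke pair. -/
instance : IsHeckePair (proRadical F D m) where
  finite_leftCosets := by
    intro g
    obtain ⟨π, hπ0, hπ1, hπ⟩ := exists_uniformizer F
    obtain ⟨B, hB⟩ := exists_entry_bound F (g : Matrix (Fin m) (Fin m) D)
    obtain ⟨B', hB'⟩ := exists_entry_bound F ((g⁻¹ : GL (Fin m) D) : Matrix (Fin m) (Fin m) D)
    have : MulArchimedean (ValueGroupWithZero F) :=
      ValuativeRel.isRankLeOne_iff_mulArchimedean.mp inferInstance
    obtain ⟨n, hn⟩ := exists_pow_lt₀ (a := valuation F π ^ Module.finrank F D)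
      (pow_lt_one₀ zero_le hπ1 Module.finrank_pos.ne') (B' * B)⁻¹
    have hc : (B' : ValueGroupWithZero F) * (valuation F π ^ Module.finrank F D) ^ n * B < 1 := by
      rw [mul_right_comm, ← Units.val_mul]
      calc _ < ((B' * B : (ValueGroupWithZero F)ˣ) : ValueGroupWithZero F) *
            (((B' * B)⁻¹ : (ValueGroupWithZero F)ˣ) : ValueGroupWithZero F) :=
            mul_lt_mul_of_pos_left hn (zero_lt_iff.mpr (Units.ne_zero _))
        _ = 1 := Units.mul_inv _
    obtain ⟨R, hR, hR'⟩ := exists_finite_mod_pow F D hπ0 hπ n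
    choose! r hrR hr using hR'
    have hex : ∀ q ∈ (fun x : GL (Fin m) D => (x : GL (Fin m) D ⧸ proRadical F D m)) ''
        doubleCoset g (proRadical F D m : Set (GL (Fin m) D)) (proRadical F D m), ∃ k,
        k ∈ proRadical F D m ∧ q = ((k * g : GL (Fin m) D) : GL (Fin m) D ⧸ proRadical F D m) := by
      rintro _ ⟨x, hx, rfl⟩
      obtain ⟨a, ha, b, hb, rfl⟩ := mem_doubleCoset.mp hx
      exact ⟨a, ha, (QuotientGroup.eq.mpr (by
        rw [show (a * g)⁻¹ * (a * g * b) = b by group]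
        exact hb)).symm⟩
    choose! κ hκ hq using hex
    refine Set.Finite.of_injOn (f := fun q => fun i j => r ((κ q : Matrix (Fin m) (Fin m) D) i j))
      (t := Set.univ.pi fun _ => Set.univ.pi fun _ => R) ?_ ?_ ?_
    · intro q hqm i _ j _
      exact hrR _ ((hκ q hqm).1.1 i j)
    · intro q hqm q' hqm' heq
      rw [hq q hqm, hq q' hqm']
      refine QuotientGroup.eq.mpr (inv_mul_mem_proRadical F hc hB hB' (hκ q hqm) (hκ q' hqm') ?_)
      intro i j
      have h1 := hr _ ((hκ q hqm).1.1 i j)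
      have h2 := hr _ ((hκ q' hqm').1.1 i j)
      have h3 : r ((κ q : Matrix (Fin m) (Fin m) D) i j) =
          r ((κ q' : Matrix (Fin m) (Fin m) D) i j) := congrFun (congrFun heq i) j
      rw [h3] at h1
      have e : ((κ q' : Matrix (Fin m) (Fin m) D) - (κ q : Matrix (Fin m) (Fin m) D)) i j =
          ((κ q' : Matrix (Fin m) (Fin m) D) i j - r ((κ q' : Matrix (Fin m) (Fin m) D) i j)) -
          ((κ q : Matrix (Fin m) (Fin m) D) i j - r ((κ q' : Matrix (Fin m) (Fin m) D) i j)) := by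
        rw [Matrix.sub_apply]
        abel
      rw [e]
      exact (Valuation.map_sub _ _ _).trans (max_le h2 h1)
    · exact Set.Finite.pi fun _ => Set.Finite.pi fun _ => hR

end HeckePairInstance

end GLHecke

/-!
Write `f_g` for the characteristic function of `K¹gK¹`. The `f_g` span `ℋ(G, K¹)` over `ℤ`
(`HeckeAlgebra.mem_of_char_mem`), so both parts reduce to writing single `f_g` as products.

Products of double cosets are governed by `HeckeAlgebra.char_mul_char`: `f_x * f_y = f_{xy}` as soon
as `x K¹ y ⊆ K¹ x y K¹` and only the coset `x K¹` contributes to the value of the convolution at `xy`.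
This covers two cases. If `x` or `y` normalizes `K¹`, as do the elements of `K` and the powers of
`τ_0`, both conditions are immediate. If `x` is a diagonal matrix with entries of decreasing norm and
`y = τ_r`, then conjugation by `x` contracts the part below the diagonal and conjugation by `y⁻¹` the
part above it; the first condition follows from the factorization of `K¹` into block lower unipotent
and block upper triangular matrices (`exists_block_factorization`), the second from a comparison of
norms in the columns of a matrix (`mem_proRadical_of_mul`). This is `char_diagonalGL_mul_char_tau`.
Invertibility of matrices congruent to `1` modulo `℘_D` needs no completeness: an entry of maximal
norm of `C` survives in `C A` (`normValuation_le_of_mul_le`), so `A` is regular in an artinian ring.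

Gaussian elimination with pivots of maximal norm (`exists_mul_mul_eq_diagonalGL`) brings every
`g ∈ G` to diagonal form, using only the subgroup generated by the upper unipotent matrices of `K` and
the simple reflections; lower unipotent matrices come from upper ones by reversing the basis. For
`g ∈ K` the diagonal form lies in `T` modulo `K¹`, which proves the second part: the set of `k ∈ K`
with `f_k` in a given subalgebra is a group since `K / K¹` is finite. For general `g`, sorting the
diagonal entries gives the Cartan decomposition `g ∈ K δ K` (`IsUniformizer.exists_cartan`), where
`δ` is a power of `τ_0` times a product of elements `τ_α`, and multiplicativity gives the first part.
-/

/-! ### Characteristic functions of double cosets -/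

namespace HeckeAlgebra

open DoubleCoset

variable {G : Type*} [Group G] {H : Subgroup G}

theorem sub_apply (Φ Ψ : HeckeAlgebra H) (g : G) : (Φ - Ψ) g = Φ g - Ψ g := by
  rw [sub_eq_add_neg, add_apply, neg_apply, sub_eq_add_neg]

theorem char_apply_of_mem {x g : G} (h : g ∈ doubleCoset x (H : Set G) H) : char H x g = 1 := by
  rw [char_apply, Set.indicator_of_mem h, Pi.one_apply]

theorem char_apply_of_notMem {x g : G} (h : g ∉ doubleCoset x (H : Set G) H) :
    char H x g = 0 := by
  rw [char_apply, Set.indicator_of_notMem h]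

theorem mem_of_char_ne_zero {x g : G} (h : char H x g ≠ 0) : g ∈ doubleCoset x (H : Set G) H := by
  by_contra hg
  exact h (char_apply_of_notMem hg)

theorem mem_doubleCoset_self' (x : G) : x ∈ doubleCoset x (H : Set G) H :=
  mem_doubleCoset_self H H x

theorem char_mul_right (x : G) {h : G} (hh : h ∈ H) : char H (x * h) = char H x := by
  ext g
  have : doubleCoset (x * h) (H : Set G) H = doubleCoset x (H : Set G) H :=
    doubleCoset_eq_of_mem (mem_doubleCoset.mpr ⟨1, H.one_mem, h, hh, by simp⟩)
  rw [char_apply, char_apply, this]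

theorem zsmul_apply (n : ℤ) (Φ : HeckeAlgebra H) (g : G) : (n • Φ) g = n * Φ g := by
  change ((n • (Φ : G → ℤ)) g) = _
  simp

/-- `ℋ(G, H)` is spanned over `ℤ` by the characteristic functions of double cosets; more precisely,
`Φ` only involves the double cosets that it does not vanish on. -/
theorem mem_of_char_mem (A : AddSubgroup (HeckeAlgebra H)) (Φ : HeckeAlgebra H)
    (hA : ∀ x, Φ x ≠ 0 → char H x ∈ A) : Φ ∈ A := by
  classical
  have key : ∀ (S : Finset G) (Φ : HeckeAlgebra H), (∀ x, Φ x ≠ 0 → char H x ∈ A) →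
      (∀ y, Φ y ≠ 0 → ∃ x ∈ S, y ∈ doubleCoset x (H : Set G) H) → Φ ∈ A := by
    intro S
    induction S using Finset.induction_on with
    | empty =>
      intro Φ _ hS
      have : Φ = 0 := by
        ext y
        by_contra hy
        obtain ⟨x, hx, -⟩ := hS y hy
        simp at hx
      rw [this]
      exact A.zero_mem
    | insert x S _ ih =>
      intro Φ hΦ hS
      have hval : ∀ y, (Φ - Φ x • char H x) y ≠ 0 →
          y ∉ doubleCoset x (H : Set G) H ∧ Φ y ≠ 0 := by
        intro y hy
        rw [sub_apply, zsmul_apply] at hy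
        by_cases hyx : y ∈ doubleCoset x (H : Set G) H
        · rw [char_apply_of_mem hyx, Φ.isBiinvariant.apply_eq_of_mem hyx] at hy
          simp at hy
        · rw [char_apply_of_notMem hyx] at hy
          exact ⟨hyx, by simpa using hy⟩
      have h1 : Φ - Φ x • char H x ∈ A := by
        refine ih _ (fun y hy => hΦ y (hval y hy).2) fun y hy => ?_
        obtain ⟨z, hz, hyz⟩ := hS y (hval y hy).2
        rcases Finset.mem_insert.mp hz with rfl | hz
        · exact absurd hyz (hval y hy).1
        · exact ⟨z, hz, hyz⟩
      have h2 : Φ x • char H x ∈ A := by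
        by_cases hx : Φ x = 0
        · rw [hx, zero_smul]
          exact A.zero_mem
        · exact A.zsmul_mem (hΦ x hx) _
      simpa using A.add_mem h1 h2
  obtain ⟨S, hS⟩ := Φ.hasFiniteDoubleCosetSupport
  refine key S Φ hA fun y hy => ?_
  have : y ∈ Function.support Φ := hy
  rw [hS] at this
  simpa using this

variable [IsHeckePair H]

/-- If `xHy ⊆ HxyH`, and if the coset `xH` is the only one in `HxH` that contributes to the value
of the convolution at `xy`, then `f_x * f_y = f_{xy}`. -/
theorem char_mul_char {x y : G}
    (h1 : ∀ h ∈ H, x * h * y ∈ doubleCoset (x * y) (H : Set G) H)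
    (h2 : ∀ h ∈ H, (h * x)⁻¹ * (x * y) ∈ doubleCoset y (H : Set G) H → x⁻¹ * h * x ∈ H) :
    char H x * char H y = char H (x * y) := by
  have hval : (char H x * char H y) (x * y) = 1 := by
    refine (cosetSum_single (H := H) (f := fun z => char H x z * char H y (z⁻¹ * (x * y)))
      (term_mul_right (char H x).isBiinvariant (char H y).isBiinvariant _) x ?_).trans ?_
    · intro z hz
      obtain ⟨a, ha, b, hb, rfl⟩ := mem_doubleCoset.mp (mem_of_char_ne_zero (left_ne_zero_of_mul hz))
      obtain ⟨c, hc, d, hd, hcd⟩ :=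
        mem_doubleCoset.mp (mem_of_char_ne_zero (right_ne_zero_of_mul hz))
      have h3 : x⁻¹ * a * x ∈ H := by
        refine h2 a ha (mem_doubleCoset.mpr ⟨b * c, H.mul_mem hb hc, d, hd, ?_⟩)
        rw [show b * c * y * d = b * (c * y * d) by group, ← hcd]
        group
      rw [show x⁻¹ * (a * x * b) = x⁻¹ * a * x * b by group]
      exact H.mul_mem h3 hb
    · rw [char_apply_of_mem (mem_doubleCoset_self' x), inv_mul_cancel_left,
        char_apply_of_mem (mem_doubleCoset_self' y), one_mul]
  ext g
  by_cases hg : g ∈ doubleCoset (x * y) (H : Set G) H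
  · rw [char_apply_of_mem hg, (char H x * char H y).isBiinvariant.apply_eq_of_mem hg, hval]
  · rw [char_apply_of_notMem hg]
    by_contra hne
    obtain ⟨q, hq1, hq2⟩ := exists_of_conv_ne_zero hne
    obtain ⟨a, ha, b, hb, hab⟩ := mem_doubleCoset.mp (mem_of_char_ne_zero hq1)
    obtain ⟨c, hc, d, hd, hcd⟩ := mem_doubleCoset.mp (mem_of_char_ne_zero hq2)
    obtain ⟨e, he, f, hf, hef⟩ := mem_doubleCoset.mp (h1 (b * c) (H.mul_mem hb hc))
    refine hg (mem_doubleCoset.mpr ⟨a * e, H.mul_mem ha he, f * d, H.mul_mem hf hd, ?_⟩)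
    rw [show a * e * (x * y) * (f * d) = a * (e * (x * y) * f) * d by group, ← hef,
      show a * (x * (b * c) * y) * d = a * x * b * (c * y * d) by group, ← hab, ← hcd]
    group

theorem char_mul_char_of_left {x : G} (hx : ∀ h, h ∈ H ↔ x * h * x⁻¹ ∈ H) (y : G) :
    char H x * char H y = char H (x * y) := by
  refine char_mul_char (fun h hh => ?_) fun h hh _ => ?_
  · exact mem_doubleCoset.mpr ⟨_, (hx h).mp hh, 1, H.one_mem, by group⟩
  · rw [hx]
    simpa [mul_assoc] using hh

theorem char_mul_char_of_right (x : G) {y : G} (hy : ∀ h, h ∈ H ↔ y * h * y⁻¹ ∈ H) :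
    char H x * char H y = char H (x * y) := by
  refine char_mul_char (fun h hh => ?_) fun h hh hm => ?_
  · refine mem_doubleCoset.mpr ⟨1, H.one_mem, y⁻¹ * h * y, (hy _).mpr ?_, by group⟩
    simpa [mul_assoc] using hh
  · obtain ⟨a, ha, b, hb, hab⟩ := mem_doubleCoset.mp hm
    have : x⁻¹ * h * x = (a * (y * b * y⁻¹))⁻¹ := by
      rw [show a * (y * b * y⁻¹) = a * y * b * y⁻¹ by group, ← hab]
      group
    rw [this]
    exact H.inv_mem (H.mul_mem ha ((hy b).mp hb))

end HeckeAlgebra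

namespace GLHecke

open ValuativeRel DoubleCoset Matrix

section CongruenceSubgroup

variable {F : Type*} [Field F] [ValuativeRel F] [TopologicalSpace F] [IsNonarchimedeanLocalField F]
variable {D : Type*} [DivisionRing D] [Algebra F D] [FiniteDimensional F D] {m : ℕ}

/-! ### The congruence subgroup `K¹` -/

/-- Right multiplication by a matrix congruent to `1` modulo `℘_D` does not shrink the maximal norm
of the entries: an entry of `C` of maximal norm dominates its perturbation. -/
theorem normValuation_le_of_mul_le {A C : Matrix (Fin m) (Fin m) D}
    (hA : ∀ i j, normValuation F D ((A - 1) i j) < 1) {c : ValueGroupWithZero F}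
    (hC : ∀ i j, normValuation F D ((C * A) i j) ≤ c) (i j : Fin m) :
    normValuation F D (C i j) ≤ c := by
  obtain ⟨p, -, hp⟩ := Finset.exists_max_image Finset.univ
    (fun p : Fin m × Fin m => normValuation F D (C p.1 p.2)) ⟨(i, j), Finset.mem_univ _⟩
  refine (hp (i, j) (Finset.mem_univ _)).trans ?_
  by_contra! hc
  have h0 : normValuation F D (C p.1 p.2) ≠ 0 := (zero_le.trans_lt hc).ne'
  have e : C p.1 p.2 = (C * A) p.1 p.2 - (C * (A - 1)) p.1 p.2 := by
    rw [← Matrix.sub_apply, mul_sub, mul_one, sub_sub_cancel]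
  refine lt_irrefl (normValuation F D (C p.1 p.2)) ?_
  conv_lhs => rw [e]
  refine (Valuation.map_sub _ _ _).trans_lt (max_lt ((hC _ _).trans_lt hc) ?_)
  rw [mul_apply]
  refine Valuation.map_sum_lt _ h0 fun k _ => ?_
  rw [map_mul]
  calc _ ≤ normValuation F D (C p.1 p.2) * normValuation F D ((A - 1) k p.2) :=
        mul_le_mul_left (hp (p.1, k) (Finset.mem_univ _)) _
    _ < normValuation F D (C p.1 p.2) * 1 := mul_lt_mul_of_pos_left (hA _ _) (zero_lt_iff.mpr h0)
    _ = _ := mul_one _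

theorem isUnit_of_sub_one_lt {A : Matrix (Fin m) (Fin m) D}
    (hA : ∀ i j, normValuation F D ((A - 1) i j) < 1) : IsUnit A := by
  rw [IsArtinianRing.isUnit_iff_isRightRegular]
  intro B C hBC
  have hBC : B * A = C * A := hBC
  rw [← sub_eq_zero]
  ext i j
  have := normValuation_le_of_mul_le (F := F) (A := A) (C := B - C) hA (c := 0)
    (fun i j => by rw [sub_mul, hBC, sub_self, Matrix.zero_apply, map_zero]) i j
  simpa using this

theorem normValuation_one_le (i j : Fin m) :
    normValuation F D ((1 : Matrix (Fin m) (Fin m) D) i j) ≤ 1 := by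
  rw [one_apply]
  split_ifs <;> simp

theorem normValuation_le_one_of_sub_one_lt {A : Matrix (Fin m) (Fin m) D}
    (hA : ∀ i j, normValuation F D ((A - 1) i j) < 1) (i j : Fin m) :
    normValuation F D (A i j) ≤ 1 := by
  rw [← sub_add_cancel A 1, Matrix.add_apply]
  exact (Valuation.map_add _ _ _).trans (max_le (hA i j).le (normValuation_one_le i j))

theorem mem_proRadical_iff {g : GL (Fin m) D} : g ∈ proRadical F D m ↔
    ∀ i j, normValuation F D (((g : Matrix (Fin m) (Fin m) D) - 1) i j) < 1 := by
  refine ⟨fun h => h.2, fun h => ⟨⟨normValuation_le_one_of_sub_one_lt h, ?_⟩, h⟩⟩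
  refine fun i j => normValuation_le_of_mul_le (F := F) h (c := 1) (fun i j => ?_) i j
  rw [Units.inv_mul]
  exact normValuation_one_le i j

theorem normValuation_mul_lt {A B : Matrix (Fin m) (Fin m) D}
    (hA : ∀ i j, normValuation F D (A i j) < 1) (hB : ∀ i j, normValuation F D (B i j) ≤ 1)
    (i j : Fin m) : normValuation F D ((A * B) i j) < 1 := by
  rw [mul_apply]
  refine Valuation.map_sum_lt _ one_ne_zero fun k _ => ?_
  rw [map_mul]
  exact (mul_le_of_le_one_right' (hB k j)).trans_lt (hA i k)

theorem normValuation_mul_lt' {A B : Matrix (Fin m) (Fin m) D}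
    (hA : ∀ i j, normValuation F D (A i j) ≤ 1) (hB : ∀ i j, normValuation F D (B i j) < 1)
    (i j : Fin m) : normValuation F D ((A * B) i j) < 1 := by
  rw [mul_apply]
  refine Valuation.map_sum_lt _ one_ne_zero fun k _ => ?_
  rw [map_mul]
  exact (mul_le_of_le_one_left' (hA i k)).trans_lt (hB k j)

theorem conj_mem_proRadical {k h : GL (Fin m) D} (hk : k ∈ maxCompact F D m)
    (hh : h ∈ proRadical F D m) : k * h * k⁻¹ ∈ proRadical F D m := by
  rw [mem_proRadical_iff] at hh ⊢
  have e : ((k * h * k⁻¹ : GL (Fin m) D) : Matrix (Fin m) (Fin m) D) - 1 =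
      (k : Matrix (Fin m) (Fin m) D) * ((h : Matrix (Fin m) (Fin m) D) - 1) *
        ((k⁻¹ : GL (Fin m) D) : Matrix (Fin m) (Fin m) D) := by
    rw [mul_sub, sub_mul, mul_one, Units.mul_inv]
    rfl
  rw [e]
  exact normValuation_mul_lt (normValuation_mul_lt' hk.1 hh) hk.2

theorem mem_proRadical_iff_conj {k : GL (Fin m) D} (hk : k ∈ maxCompact F D m)
    (h : GL (Fin m) D) : h ∈ proRadical F D m ↔ k * h * k⁻¹ ∈ proRadical F D m := by
  refine ⟨conj_mem_proRadical hk, fun hh => ?_⟩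
  have := conj_mem_proRadical (inv_mem hk) hh
  rwa [show k⁻¹ * (k * h * k⁻¹) * k⁻¹⁻¹ = h by group] at this

/-- Two elements of `K` with the same reduction modulo `℘_D` lie in the same coset of `K¹`. -/
theorem inv_mul_mem_proRadical_of_sub_lt {k l : GL (Fin m) D} (hk : k ∈ maxCompact F D m)
    (h : ∀ i j, normValuation F D
      (((l : Matrix (Fin m) (Fin m) D) - (k : Matrix (Fin m) (Fin m) D)) i j) < 1) :
    k⁻¹ * l ∈ proRadical F D m := by
  rw [mem_proRadical_iff]
  have e : ((k⁻¹ * l : GL (Fin m) D) : Matrix (Fin m) (Fin m) D) - 1 =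
      ((k⁻¹ : GL (Fin m) D) : Matrix (Fin m) (Fin m) D) *
        ((l : Matrix (Fin m) (Fin m) D) - (k : Matrix (Fin m) (Fin m) D)) := by
    rw [mul_sub, Units.inv_mul]
    rfl
  rw [e]
  exact normValuation_mul_lt' hk.2 h

/-! ### Diagonal matrices -/

theorem diagonalGL_mul (d e : Fin m → Dˣ) :
    diagonalGL d * diagonalGL e = diagonalGL fun i => d i * e i := by
  refine Units.ext ((diagonal_mul_diagonal _ _).trans ?_)
  simp [diagonalGL]

theorem diagonalGL_inv (d : Fin m → Dˣ) : (diagonalGL d)⁻¹ = diagonalGL fun i => (d i)⁻¹ := by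
  rw [inv_eq_iff_mul_eq_one, diagonalGL_mul]
  ext i j
  simp [diagonalGL]

theorem coe_diagonalGL (d : Fin m → Dˣ) :
    (diagonalGL d : Matrix (Fin m) (Fin m) D) = diagonal fun i => (d i : D) := rfl

/-- The entries of `δ g δ⁻¹ - 1`, for a diagonal matrix `δ`. -/
theorem normValuation_diagonalGL_conj (d : Fin m → Dˣ) (g : GL (Fin m) D) (i j : Fin m) :
    normValuation F D ((((diagonalGL d * g * (diagonalGL d)⁻¹ : GL (Fin m) D) :
      Matrix (Fin m) (Fin m) D) - 1) i j) = normValuation F D (d i) *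
        normValuation F D (((g : Matrix (Fin m) (Fin m) D) - 1) i j) *
          (normValuation F D (d j))⁻¹ := by
  have e : ((diagonalGL d * g * (diagonalGL d)⁻¹ : GL (Fin m) D) : Matrix (Fin m) (Fin m) D) - 1 =
      (diagonalGL d : Matrix (Fin m) (Fin m) D) * ((g : Matrix (Fin m) (Fin m) D) - 1) *
        (((diagonalGL d)⁻¹ : GL (Fin m) D) : Matrix (Fin m) (Fin m) D) := by
    rw [mul_sub, sub_mul, mul_one, Units.mul_inv]
    rfl
  rw [e, diagonalGL_inv, coe_diagonalGL, coe_diagonalGL, mul_diagonal, diagonal_mul, map_mul,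
    map_mul, Units.val_inv_eq_inv_val, map_inv₀]

theorem normValuation_unit_pos (d : Dˣ) : 0 < normValuation F D (d : D) := by
  rw [zero_lt_iff, Valuation.ne_zero_iff]
  exact d.ne_zero

/-- Conjugation by a diagonal matrix `δ` scales the norm of the `(i, j)` entry of `g - 1` by
`|δ_i| / |δ_j|`. -/
theorem diagonalGL_conj_lt {d : Fin m → Dˣ} {g : GL (Fin m) D} {i j : Fin m}
    (hd : normValuation F D (d i : D) ≤ normValuation F D (d j : D))
    (hg : normValuation F D (((g : Matrix (Fin m) (Fin m) D) - 1) i j) < 1) :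
    normValuation F D ((((diagonalGL d * g * (diagonalGL d)⁻¹ : GL (Fin m) D) :
      Matrix (Fin m) (Fin m) D) - 1) i j) < 1 := by
  rw [normValuation_diagonalGL_conj]
  have h0 := normValuation_unit_pos (F := F) (d j)
  calc _ ≤ normValuation F D (d j : D) *
        normValuation F D (((g : Matrix (Fin m) (Fin m) D) - 1) i j) *
          (normValuation F D (d j : D))⁻¹ := by gcongr
    _ = normValuation F D (((g : Matrix (Fin m) (Fin m) D) - 1) i j) := by
        rw [mul_right_comm, mul_inv_cancel₀ h0.ne', one_mul]
    _ < 1 := hg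

theorem diagonalGL_inv_conj_lt {d : Fin m → Dˣ} {g : GL (Fin m) D} {i j : Fin m}
    (hd : normValuation F D (d j : D) ≤ normValuation F D (d i : D))
    (hg : normValuation F D (((g : Matrix (Fin m) (Fin m) D) - 1) i j) < 1) :
    normValuation F D (((((diagonalGL d)⁻¹ * g * diagonalGL d : GL (Fin m) D) :
      Matrix (Fin m) (Fin m) D) - 1) i j) < 1 := by
  have h := diagonalGL_conj_lt (F := F) (d := fun i => (d i)⁻¹) (g := g) (i := i) (j := j) (by
    rw [Units.val_inv_eq_inv_val, Units.val_inv_eq_inv_val, map_inv₀, map_inv₀]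
    exact inv_anti₀ (normValuation_unit_pos _) hd) hg
  rwa [← diagonalGL_inv, inv_inv] at h

theorem diagonalGL_mem_maxCompact {d : Fin m → Dˣ} (hd : ∀ i, normValuation F D (d i : D) = 1) :
    diagonalGL d ∈ maxCompact F D m := by
  have key : ∀ e : Fin m → Dˣ, (∀ i, normValuation F D (e i : D) = 1) → ∀ i j,
      (diagonalGL e : Matrix (Fin m) (Fin m) D) i j ∈ integerRing F D := by
    intro e he i j
    rw [coe_diagonalGL, diagonal_apply]
    split_ifs
    · exact (he i).le
    · exact zero_mem _
  refine ⟨key d hd, ?_⟩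
  rw [diagonalGL_inv]
  refine key _ fun i => ?_
  rw [Units.val_inv_eq_inv_val, map_inv₀, hd, inv_one]

end CongruenceSubgroup

section Multiplicativity

variable {F : Type*} [Field F] [ValuativeRel F] [TopologicalSpace F] [IsNonarchimedeanLocalField F]
variable {D : Type*} [DivisionRing D] [Algebra F D] [FiniteDimensional F D] {m : ℕ}

/-! ### Products of contracting diagonal matrices -/

/-- If `A - 1` is small on and above the diagonal, and `hA - 1` is small on and below it for some
`h ∈ K¹`, then `A ∈ K¹`: in each column of `A` an entry of norm larger than `1` would have to lie below
the diagonal, but such an entry of maximal norm would survive in `hA`. -/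
theorem mem_proRadical_of_mul {A h : GL (Fin m) D} (hh : h ∈ proRadical F D m)
    (hA : ∀ i j, i ≤ j → normValuation F D (((A : Matrix (Fin m) (Fin m) D) - 1) i j) < 1)
    (hB : ∀ i j, j ≤ i →
      normValuation F D ((((h * A : GL (Fin m) D) : Matrix (Fin m) (Fin m) D) - 1) i j) < 1) :
    A ∈ proRadical F D m := by
  have hh' := mem_proRadical_iff.mp hh
  have hval : ∀ {B : Matrix (Fin m) (Fin m) D} {i j},
      normValuation F D ((B - 1) i j) < 1 → normValuation F D (B i j) ≤ 1 := by
    intro B i j hij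
    rw [← sub_add_cancel B 1, Matrix.add_apply]
    exact (Valuation.map_add _ _ _).trans (max_le hij.le (normValuation_one_le i j))
  have e : ∀ i j, ((h * A : GL (Fin m) D) : Matrix (Fin m) (Fin m) D) i j =
      (A : Matrix (Fin m) (Fin m) D) i j +
        (((h : Matrix (Fin m) (Fin m) D) - 1) * (A : Matrix (Fin m) (Fin m) D)) i j := by
    intro i j
    rw [← Matrix.add_apply, sub_mul, one_mul, add_sub_cancel]
    rfl
  have hint : ∀ i j, normValuation F D ((A : Matrix (Fin m) (Fin m) D) i j) ≤ 1 := by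
    intro i j
    obtain ⟨p, -, hp⟩ := Finset.exists_max_image Finset.univ
      (fun p : Fin m => normValuation F D ((A : Matrix (Fin m) (Fin m) D) p j))
      ⟨i, Finset.mem_univ _⟩
    refine (hp i (Finset.mem_univ _)).trans ?_
    by_contra! hc
    have h0 : normValuation F D ((A : Matrix (Fin m) (Fin m) D) p j) ≠ 0 :=
      (zero_lt_one.trans hc).ne'
    have hjp : j ≤ p := by
      by_contra! hpj
      exact absurd (hval (hA p j hpj.le)) hc.not_ge
    refine lt_irrefl (normValuation F D ((A : Matrix (Fin m) (Fin m) D) p j)) ?_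
    conv_lhs => rw [eq_sub_of_add_eq (e p j).symm]
    refine (Valuation.map_sub _ _ _).trans_lt (max_lt ((hval (hB p j hjp)).trans_lt hc) ?_)
    rw [mul_apply]
    refine Valuation.map_sum_lt _ h0 fun k _ => ?_
    rw [map_mul]
    calc _ ≤ normValuation F D (((h : Matrix (Fin m) (Fin m) D) - 1) p k) *
          normValuation F D ((A : Matrix (Fin m) (Fin m) D) p j) :=
          mul_le_mul_right (hp k (Finset.mem_univ _)) _
      _ < 1 * normValuation F D ((A : Matrix (Fin m) (Fin m) D) p j) :=
          mul_lt_mul_of_pos_right (hh' _ _) (zero_lt_iff.mpr h0)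
      _ = _ := one_mul _
  rw [mem_proRadical_iff]
  intro i j
  rcases le_total i j with hij | hij
  · exact hA i j hij
  · have e' : ((A : Matrix (Fin m) (Fin m) D) - 1) i j =
        (((h * A : GL (Fin m) D) : Matrix (Fin m) (Fin m) D) - 1) i j -
          (((h : Matrix (Fin m) (Fin m) D) - 1) * (A : Matrix (Fin m) (Fin m) D)) i j := by
      rw [Matrix.sub_apply, Matrix.sub_apply, e]
      abel
    rw [e']
    exact (Valuation.map_sub _ _ _).trans_lt
      (max_lt (hB i j hij) (normValuation_mul_lt hh' hint i j))

/-- Block elimination in `K¹`: every `h ∈ K¹` is a product `l u` in `K¹`, with `l` unipotent and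
block lower triangular, and `u` block upper triangular, for the partition `m = r + (m - r)`. -/
theorem exists_block_factorization {h : GL (Fin m) D} (hh : h ∈ proRadical F D m) (r : ℕ) :
    ∃ l ∈ proRadical F D m, ∃ u ∈ proRadical F D m, h = l * u ∧
      (∀ i j : Fin m, ¬ ((j : ℕ) < r ∧ r ≤ (i : ℕ)) →
        ((l : Matrix (Fin m) (Fin m) D) - 1) i j = 0) ∧
      ∀ i j : Fin m, (j : ℕ) < r → r ≤ (i : ℕ) →
        ((u : Matrix (Fin m) (Fin m) D) - 1) i j = 0 := by
  have hh' := mem_proRadical_iff.mp hh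
  set k := (h : Matrix (Fin m) (Fin m) D) with hk
  -- `P` projects to the first `r` coordinates, `A` is the upper left block of `h`, completed by `1`
  set P : Matrix (Fin m) (Fin m) D := diagonal fun j => if (j : ℕ) < r then 1 else 0 with hP
  have hPP : P * P = P := by
    rw [hP, diagonal_mul_diagonal]
    congr 1
    ext j
    split_ifs <;> simp
  have hA : ∀ i j, normValuation F D ((P * k * P + (1 - P) - 1) i j) < 1 := by
    intro i j
    rw [show P * k * P + (1 - P) - 1 = P * (k - 1) * P by
      rw [mul_sub, sub_mul, mul_one, hPP]; abel, hP, mul_diagonal, diagonal_mul]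
    split_ifs
    · simpa only [one_mul, mul_one] using hh' i j
    all_goals simp
  obtain ⟨A, hAval⟩ := isUnit_of_sub_one_lt hA
  have hAmem : A ∈ proRadical F D m := mem_proRadical_iff.mpr fun i j => by
    rw [hAval]
    exact hA i j
  set B : Matrix (Fin m) (Fin m) D := ((A⁻¹ : GL (Fin m) D) : Matrix (Fin m) (Fin m) D) with hB
  have hAP : (A : Matrix (Fin m) (Fin m) D) * P = P * k * P := by
    rw [hAval, add_mul, sub_mul, one_mul, mul_assoc (P * k), hPP, sub_self, add_zero]
  have hPA : P * (A : Matrix (Fin m) (Fin m) D) = P * k * P := by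
    rw [hAval, mul_add, mul_sub, mul_one, ← mul_assoc, ← mul_assoc, hPP, sub_self, add_zero]
  have hBA : B * (A : Matrix (Fin m) (Fin m) D) = 1 := Units.inv_mul A
  set X : Matrix (Fin m) (Fin m) D := (1 - P) * (k - 1) * P * B * P with hX
  have hXP : X * P = X := by rw [hX, mul_assoc _ P P, hPP]
  have hPX : P * X = 0 := by
    have : P * (1 - P) = 0 := by rw [mul_sub, mul_one, hPP, sub_self]
    rw [hX]
    simp only [← mul_assoc, this, zero_mul]
  have hXX : X * X = 0 := by
    calc X * X = X * P * X := by rw [hXP]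
      _ = 0 := by rw [mul_assoc, hPX, mul_zero]
  have hXk : X * k * P = (1 - P) * k * P := by
    calc X * k * P = X * P * k * P := by rw [hXP]
      _ = X * (A : Matrix (Fin m) (Fin m) D) * P := by
          rw [mul_assoc X (A : Matrix (Fin m) (Fin m) D), hAP]
          simp only [mul_assoc]
      _ = (1 - P) * (k - 1) * P * B * (P * (A : Matrix (Fin m) (Fin m) D)) * P := by
          rw [hX]
          simp only [mul_assoc]
      _ = (1 - P) * (k - 1) * P * (B * (A : Matrix (Fin m) (Fin m) D)) * P * P := by
          rw [hPA, ← hAP]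
          simp only [mul_assoc]
      _ = (1 - P) * (k - 1) * P := by
          rw [hBA, mul_one, mul_assoc _ P P, hPP, mul_assoc _ P P, hPP]
      _ = (1 - P) * k * P := by
          rw [mul_sub, mul_one, sub_mul ((1 - P) * k), sub_mul 1 P P, one_mul, hPP, sub_self,
            sub_zero]
  have hXlt : ∀ i j, normValuation F D (X i j) < 1 := by
    have hP1 : ∀ i j, normValuation F D (P i j) ≤ 1 := by
      intro i j
      rw [hP, diagonal_apply]
      split_ifs <;> simp
    have hP1' : ∀ i j, normValuation F D ((1 - P) i j) ≤ 1 := fun i j =>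
      (Valuation.map_sub _ _ _).trans (max_le (normValuation_one_le i j) (hP1 i j))
    exact normValuation_mul_lt (normValuation_mul_lt (normValuation_mul_lt
      (normValuation_mul_lt' hP1' hh') hP1) hAmem.1.2) hP1
  let l : GL (Fin m) D :=
    { val := 1 + X
      inv := 1 - X
      val_inv := by rw [mul_sub, mul_one, add_mul, one_mul, hXX]; abel
      inv_val := by rw [mul_add, mul_one, sub_mul, one_mul, hXX]; abel }
  have hl1 : (l : Matrix (Fin m) (Fin m) D) - 1 = X := add_sub_cancel_left 1 X
  have hl : l ∈ proRadical F D m := mem_proRadical_iff.mpr fun i j => by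
    rw [hl1]
    exact hXlt i j
  refine ⟨l, hl, l⁻¹ * h, mul_mem (inv_mem hl) hh, by group, fun i j hij => ?_,
    fun i j hj hi => ?_⟩
  · rw [hl1, ← hXP, ← sub_zero (X * P), ← zero_mul P, ← hPX, ← sub_mul]
    rw [show X - P * X = (1 - P) * X by rw [sub_mul, one_mul], hP, mul_diagonal,
      ← diagonal_one, diagonal_sub, diagonal_mul]
    by_cases hj : (j : ℕ) < r
    · have hi : (i : ℕ) < r := by
        by_contra! hi
        exact hij ⟨hj, hi⟩
      simp [hi]
    · simp [hj]
  · have hne : i ≠ j := by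
      rintro rfl
      omega
    have hz : (1 - P) * ((1 - X) * k) * P = 0 := by
      have : (1 - P) * X = X := by rw [sub_mul, one_mul, hPX, sub_zero]
      calc (1 - P) * ((1 - X) * k) * P = (1 - P) * k * P - (1 - P) * X * k * P := by noncomm_ring
        _ = 0 := by rw [this, hXk, sub_self]
    have hz' := congrFun (congrFun hz i) j
    rw [hP, mul_diagonal, ← diagonal_one, diagonal_sub, diagonal_mul] at hz'
    rw [Matrix.sub_apply, one_apply_ne hne, sub_zero]
    have hi' : ¬ (i : ℕ) < r := by omega
    change ((1 - X) * k) i j = 0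
    simpa [hj, hi'] using hz'

theorem tau_apply_le {ϖ : Dˣ} (h1 : normValuation F D (ϖ : D) < 1) (r : ℕ) {i j : Fin m}
    (hij : ¬ ((j : ℕ) < r ∧ r ≤ (i : ℕ)) ) :
    normValuation F D (((if (j : ℕ) < r then 1 else ϖ : Dˣ)) : D) ≤
      normValuation F D (((if (i : ℕ) < r then 1 else ϖ : Dˣ)) : D) := by
  split_ifs with hj hi hi
  · exact le_rfl
  · exact absurd ⟨hj, not_lt.mp hi⟩ hij
  · simpa using h1.le
  · exact le_rfl

/-- `f_δ * f_{τ_r} = f_{δ τ_r}` for a diagonal matrix `δ` whose entries decrease in norm. -/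
theorem char_diagonalGL_mul_char_tau {d : Fin m → Dˣ}
    (hd : ∀ i j, i ≤ j → normValuation F D (d j : D) ≤ normValuation F D (d i : D)) {ϖ : Dˣ}
    (h1 : normValuation F D (ϖ : D) < 1) (r : ℕ) :
    HeckeAlgebra.char (proRadical F D m) (diagonalGL d) *
      HeckeAlgebra.char (proRadical F D m) (tau m ϖ r) =
        HeckeAlgebra.char (proRadical F D m) (diagonalGL d * tau m ϖ r) := by
  refine HeckeAlgebra.char_mul_char (fun h hh => ?_) fun h hh hm => ?_
  · obtain ⟨l, hl, u, hu, rfl, hl', hu'⟩ := exists_block_factorization hh r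
    refine mem_doubleCoset.mpr ⟨diagonalGL d * l * (diagonalGL d)⁻¹, ?_,
      (tau m ϖ r)⁻¹ * u * tau m ϖ r, ?_, by group⟩
    · refine mem_proRadical_iff.mpr fun i j => ?_
      by_cases hij : (j : ℕ) < r ∧ r ≤ (i : ℕ)
      · exact diagonalGL_conj_lt (hd _ _ (Fin.le_def.mpr (by omega))) (mem_proRadical_iff.mp hl i j)
      · rw [normValuation_diagonalGL_conj, hl' i j hij]
        simp
    · refine mem_proRadical_iff.mpr fun i j => ?_
      by_cases hij : (j : ℕ) < r ∧ r ≤ (i : ℕ)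
      · have h := normValuation_diagonalGL_conj (F := F)
          (fun i => (if (i : ℕ) < r then 1 else ϖ : Dˣ)⁻¹) u i j
        rw [hu' i j hij.1 hij.2, ← diagonalGL_inv, inv_inv] at h
        unfold tau
        rw [h]
        simp
      · exact diagonalGL_inv_conj_lt (tau_apply_le h1 r hij) (mem_proRadical_iff.mp hu i j)
  · obtain ⟨a, ha, b, hb, hab⟩ := mem_doubleCoset.mp hm
    have hA : (diagonalGL d)⁻¹ * h⁻¹ * diagonalGL d = a * (tau m ϖ r * b * (tau m ϖ r)⁻¹) := by
      rw [show a * (tau m ϖ r * b * (tau m ϖ r)⁻¹) = a * tau m ϖ r * b * (tau m ϖ r)⁻¹ by group,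
        ← hab]
      group
    have hmem : (diagonalGL d)⁻¹ * h⁻¹ * diagonalGL d ∈ proRadical F D m := by
      refine mem_proRadical_of_mul (inv_mem ha) (fun i j hij => ?_) fun i j hij => ?_
      · exact diagonalGL_inv_conj_lt (hd i j hij) (mem_proRadical_iff.mp (inv_mem hh) i j)
      · rw [hA, inv_mul_cancel_left]
        exact diagonalGL_conj_lt (tau_apply_le h1 r (by rw [Fin.le_def] at hij; omega))
          (mem_proRadical_iff.mp hb i j)
    have := inv_mem hmem
    rwa [show ((diagonalGL d)⁻¹ * h⁻¹ * diagonalGL d)⁻¹ = (diagonalGL d)⁻¹ * h * diagonalGL d by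
      group] at this

end Multiplicativity

section Elimination

/-! ### Permutation matrices and Gaussian elimination -/

section Permutation

variable {D : Type*} [DivisionRing D] {m : ℕ}

variable (D) in
/-- The permutation matrix of `σ`, which maps the `j`-th basis vector to the `σ j`-th one. -/
def permGL : Equiv.Perm (Fin m) →* GL (Fin m) D :=
  MonoidHom.toHomUnits
    { toFun := fun σ => Matrix.of fun i j => if i = σ j then 1 else 0
      map_one' := by
        ext i j
        rw [one_apply]
        rfl
      map_mul' := fun σ τ => by
        ext i j
        rw [mul_apply, Finset.sum_eq_single (τ j)]
        · simp only [of_apply, if_true, mul_one]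
          rfl
        · intro k _ hk
          simp only [of_apply, if_neg hk, mul_zero]
        · simp }

theorem coe_permGL_apply (σ : Equiv.Perm (Fin m)) (i j : Fin m) :
    (permGL D σ : Matrix (Fin m) (Fin m) D) i j = if i = σ j then 1 else 0 := rfl

theorem permGL_mul_apply (σ : Equiv.Perm (Fin m)) (g : GL (Fin m) D) (i j : Fin m) :
    ((permGL D σ * g : GL (Fin m) D) : Matrix (Fin m) (Fin m) D) i j =
      (g : Matrix (Fin m) (Fin m) D) (σ⁻¹ i) j := by
  rw [Units.val_mul, mul_apply, Finset.sum_eq_single (σ⁻¹ i)]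
  · simp [coe_permGL_apply]
  · intro k _ hk
    rw [coe_permGL_apply, if_neg, zero_mul]
    rintro rfl
    simp at hk
  · simp

theorem mul_permGL_apply (σ : Equiv.Perm (Fin m)) (g : GL (Fin m) D) (i j : Fin m) :
    ((g * permGL D σ : GL (Fin m) D) : Matrix (Fin m) (Fin m) D) i j =
      (g : Matrix (Fin m) (Fin m) D) i (σ j) := by
  rw [Units.val_mul, mul_apply, Finset.sum_eq_single (σ j)]
  · simp [coe_permGL_apply]
  · intro k _ hk
    rw [coe_permGL_apply, if_neg hk, mul_zero]
  · simp

theorem simpleReflection_eq_permGL (a : Fin (m - 1)) :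
    simpleReflection D a =
      permGL D (Equiv.swap (⟨a, by omega⟩ : Fin m) ⟨a + 1, by omega⟩) := by
  ext i j
  change (Equiv.swap (⟨a, by omega⟩ : Fin m) ⟨a + 1, by omega⟩).toPEquiv.toMatrix i j = _
  rw [coe_permGL_apply, PEquiv.toMatrix_apply]
  congr 1
  rw [Equiv.toPEquiv_apply, Option.mem_some_iff, eq_iff_iff, Equiv.swap_apply_eq_iff, eq_comm]

theorem permGL_mem {M : Subgroup (GL (Fin m) D)}
    (hs : ∀ a : Fin (m - 1), simpleReflection D a ∈ M) (σ : Equiv.Perm (Fin m)) :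
    permGL D σ ∈ M := by
  cases m with
  | zero =>
    rw [Subsingleton.elim σ 1, map_one]
    exact M.one_mem
  | succ n =>
    have h : Submonoid.closure (Set.range fun i : Fin n => Equiv.swap i.castSucc i.succ) ≤
        (M.comap (permGL D)).toSubmonoid := by
      rw [Submonoid.closure_le]
      rintro _ ⟨i, rfl⟩
      have := hs i
      rw [simpleReflection_eq_permGL] at this
      exact this
    rw [Equiv.Perm.mclosure_swap_castSucc_succ] at h
    exact h (Submonoid.mem_top σ)

/-- The unipotent matrix `1 - N`, for a matrix `N` of square zero. -/
def oneSub (N : Matrix (Fin m) (Fin m) D) (hN : N * N = 0) : GL (Fin m) D where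
  val := 1 - N
  inv := 1 + N
  val_inv := by rw [mul_add, mul_one, sub_mul, one_mul, hN]; abel
  inv_val := by rw [mul_sub, mul_one, add_mul, one_mul, hN]; abel

/-- A diagonal coefficient of an invertible matrix is nonzero if it is the only possibly nonzero one
of its row. -/
theorem apply_ne_zero_of_row {g : GL (Fin m) D} {i : Fin m}
    (h : ∀ j, j ≠ i → (g : Matrix (Fin m) (Fin m) D) i j = 0) :
    (g : Matrix (Fin m) (Fin m) D) i i ≠ 0 := by
  intro h0
  have h1 : ((g : Matrix (Fin m) (Fin m) D) *
      ((g⁻¹ : GL (Fin m) D) : Matrix (Fin m) (Fin m) D)) i i = 1 := by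
    rw [Units.mul_inv, one_apply_eq]
  rw [mul_apply, Finset.sum_eq_zero] at h1
  · exact zero_ne_one h1
  · intro k _
    by_cases hk : k = i
    · rw [hk, h0, zero_mul]
    · rw [h k hk, zero_mul]

theorem exists_eq_diagonalGL {g : GL (Fin m) D}
    (h : ∀ i j, i ≠ j → (g : Matrix (Fin m) (Fin m) D) i j = 0) :
    ∃ d : Fin m → Dˣ, g = diagonalGL d := by
  refine ⟨fun i => Units.mk0 _ (apply_ne_zero_of_row fun j hj => h i j hj.symm), ?_⟩
  ext i j
  rw [coe_diagonalGL, diagonal_apply]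
  split_ifs with hij
  · rw [hij]
    rfl
  · exact h i j hij

end Permutation

variable {F : Type*} [Field F] [ValuativeRel F] [TopologicalSpace F] [IsNonarchimedeanLocalField F]
variable {D : Type*} [DivisionRing D] [Algebra F D] [FiniteDimensional F D] {m : ℕ}

theorem permGL_mem_maxCompact (σ : Equiv.Perm (Fin m)) : permGL D σ ∈ maxCompact F D m := by
  have h : ∀ (σ : Equiv.Perm (Fin m)) i j,
      (permGL D σ : Matrix (Fin m) (Fin m) D) i j ∈ integerRing F D := by
    intro σ i j
    rw [coe_permGL_apply]
    split_ifs
    · exact one_mem _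
    · exact zero_mem _
  refine ⟨h σ, ?_⟩
  rw [← map_inv]
  exact h σ⁻¹

theorem simpleReflection_mem_maxCompact (a : Fin (m - 1)) :
    simpleReflection D a ∈ maxCompact F D m := by
  rw [simpleReflection_eq_permGL]
  exact permGL_mem_maxCompact _

theorem oneSub_mem_maxCompact {N : Matrix (Fin m) (Fin m) D} (hN : N * N = 0)
    (h : ∀ i j, N i j ∈ integerRing F D) : oneSub N hN ∈ maxCompact F D m := by
  have h1 : ∀ i j, (1 : Matrix (Fin m) (Fin m) D) i j ∈ integerRing F D := fun i j =>
    normValuation_one_le i j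
  exact ⟨fun i j => sub_mem (h1 i j) (h i j), fun i j => add_mem (h1 i j) (h i j)⟩

/-- A subgroup that contains the integral upper unipotent matrices and the permutation matrices also
contains the integral lower unipotent ones: they are conjugate by the permutation that reverses the
basis. -/
theorem lowerUnipotent_mem {M : Subgroup (GL (Fin m) D)} (hU : upperUnipotent F D m ⊆ M)
    (hs : ∀ a : Fin (m - 1), simpleReflection D a ∈ M) {g : GL (Fin m) D}
    (hg : g ∈ maxCompact F D m) (h1 : ∀ i, (g : Matrix (Fin m) (Fin m) D) i i = 1)
    (h0 : ∀ i j, i < j → (g : Matrix (Fin m) (Fin m) D) i j = 0) : g ∈ M := by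
  have hw := permGL_mem hs Fin.revPerm
  have key : permGL D Fin.revPerm * g * permGL D Fin.revPerm ∈ M := by
    refine hU ⟨mul_mem (mul_mem (permGL_mem_maxCompact _) hg) (permGL_mem_maxCompact _), ?_, ?_⟩
    · intro i
      rw [mul_permGL_apply, permGL_mul_apply]
      exact h1 _
    · intro i j hij
      rw [mul_permGL_apply, permGL_mul_apply]
      exact h0 _ _ (Fin.rev_lt_rev.mpr hij)
  have := M.mul_mem (M.mul_mem (M.inv_mem hw) key) (M.inv_mem hw)
  rwa [show (permGL D Fin.revPerm)⁻¹ * (permGL D Fin.revPerm * g * permGL D Fin.revPerm) *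
    (permGL D Fin.revPerm)⁻¹ = g by group] at this

/-- Clearing the row and the column of the pivot at `(s, s)`, if its norm is maximal in the lower right
block that starts there. The pivot is nonzero because the row `s` of `y` is. -/
theorem exists_clear_pivot {M : Subgroup (GL (Fin m) D)} (hU : upperUnipotent F D m ⊆ M)
    (hs : ∀ a : Fin (m - 1), simpleReflection D a ∈ M) {y : GL (Fin m) D} {s : Fin m}
    (hy0 : ∀ i j, i ≠ j → (i < s ∨ j < s) → (y : Matrix (Fin m) (Fin m) D) i j = 0)
    (hymax : ∀ i j, s ≤ i → s ≤ j → normValuation F D ((y : Matrix (Fin m) (Fin m) D) i j) ≤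
      normValuation F D ((y : Matrix (Fin m) (Fin m) D) s s)) :
    ∃ l ∈ M, ∃ k ∈ M, ∀ i j, i ≠ j → (i ≤ s ∨ j ≤ s) →
      ((l * y * k : GL (Fin m) D) : Matrix (Fin m) (Fin m) D) i j = 0 := by
  have hpiv : (y : Matrix (Fin m) (Fin m) D) s s ≠ 0 := by
    intro h0
    refine apply_ne_zero_of_row (g := y) (i := s) (fun j hj => ?_) h0
    rcases lt_or_ge j s with hjs | hjs
    · exact hy0 s j hj.symm (Or.inr hjs)
    · have := hymax s j le_rfl hjs
      rwa [h0, map_zero, le_zero_iff, map_eq_zero] at this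
  have hvpiv : normValuation F D ((y : Matrix (Fin m) (Fin m) D) s s) ≠ 0 := by
    rwa [Valuation.ne_zero_iff]
  -- clear the column, then the row, of the pivot
  let Y : Fin m → D := fun i => if s < i then
    (y : Matrix (Fin m) (Fin m) D) i s * ((y : Matrix (Fin m) (Fin m) D) s s)⁻¹ else 0
  let Z : Fin m → D := fun j => if s < j then
    ((y : Matrix (Fin m) (Fin m) D) s s)⁻¹ * (y : Matrix (Fin m) (Fin m) D) s j else 0
  have hYs : Y s = 0 := if_neg (lt_irrefl s)
  have hZs : Z s = 0 := if_neg (lt_irrefl s)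
  let N : Matrix (Fin m) (Fin m) D := Matrix.of fun i j => if j = s then Y i else 0
  let N' : Matrix (Fin m) (Fin m) D := Matrix.of fun i j => if i = s then Z j else 0
  have hN : N * N = 0 := by
    ext i j
    simp [N, mul_apply, hYs]
  have hN' : N' * N' = 0 := by
    ext i j
    simp [N', mul_apply, hZs]
  have hNint : ∀ i j, N i j ∈ integerRing F D := by
    intro i j
    simp only [N, Y, of_apply]
    split_ifs with h1 h2
    · rw [mem_integerRing, map_mul, map_inv₀]
      exact mul_inv_le_one_of_le₀ (hymax i s h2.le le_rfl) zero_le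
    all_goals exact zero_mem _
  have hNint' : ∀ i j, N' i j ∈ integerRing F D := by
    intro i j
    simp only [N', Z, of_apply]
    split_ifs with h1 h2
    · rw [mem_integerRing, map_mul, map_inv₀]
      exact inv_mul_le_one_of_le₀ (hymax s j le_rfl h2.le) zero_le
    all_goals exact zero_mem _
  have hNM : oneSub N hN ∈ M := by
    refine lowerUnipotent_mem hU hs (oneSub_mem_maxCompact hN hNint) (fun i => ?_)
      fun i j hij => ?_
    · change (1 - N) i i = 1
      have : N i i = 0 := by
        by_cases his : i = s
        · simp [N, his, hYs]
        · simp [N, his]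
      rw [Matrix.sub_apply, this, one_apply_eq, sub_zero]
    · change (1 - N) i j = 0
      have : N i j = 0 := by
        by_cases hjs : j = s
        · simp [N, Y, hjs, (hjs ▸ hij).le]
        · simp [N, hjs]
      rw [Matrix.sub_apply, this, one_apply_ne hij.ne, sub_zero]
  have hNM' : oneSub N' hN' ∈ M := by
    refine hU ⟨oneSub_mem_maxCompact hN' hNint', fun i => ?_, fun i j hij => ?_⟩
    · change (1 - N') i i = 1
      have : N' i i = 0 := by
        by_cases his : i = s
        · simp [N', his, hZs]
        · simp [N', his]
      rw [Matrix.sub_apply, this, one_apply_eq, sub_zero]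
    · change (1 - N') i j = 0
      have : N' i j = 0 := by
        by_cases his : i = s
        · simp [N', Z, his, (his ▸ hij).le]
        · simp [N', his]
      rw [Matrix.sub_apply, this, one_apply_ne hij.ne', sub_zero]
  refine ⟨oneSub N hN, hNM, oneSub N' hN', hNM', fun i j hij hlt => ?_⟩
  have hz : ∀ i j, ((1 - N) * (y : Matrix (Fin m) (Fin m) D)) i j =
      (y : Matrix (Fin m) (Fin m) D) i j - Y i * (y : Matrix (Fin m) (Fin m) D) s j := by
    intro i j
    rw [sub_mul, one_mul, Matrix.sub_apply, mul_apply]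
    simp [N]
  have hz' : (((1 - N) * (y : Matrix (Fin m) (Fin m) D)) * (1 - N')) i j =
      ((1 - N) * (y : Matrix (Fin m) (Fin m) D)) i j -
        ((1 - N) * (y : Matrix (Fin m) (Fin m) D)) i s * Z j := by
    rw [mul_sub, mul_one, Matrix.sub_apply, mul_apply (M := (1 - N) * _)]
    simp [N']
  change (((1 - N) * (y : Matrix (Fin m) (Fin m) D)) * (1 - N')) i j = 0
  rw [hz', hz, hz]
  -- the entries of the pivot column below the pivot are cleared
  have hcol : ∀ i, i ≠ s → (y : Matrix (Fin m) (Fin m) D) i s -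
      Y i * (y : Matrix (Fin m) (Fin m) D) s s = 0 := by
    intro i hi
    rcases lt_or_gt_of_ne hi with his | his
    · rw [hy0 i s hi (Or.inl his), show Y i = 0 from if_neg his.not_gt, zero_mul, sub_zero]
    · rw [show Y i = _ from if_pos his, inv_mul_cancel_right₀ hpiv, sub_self]
  by_cases his : i = s
  · subst his
    rw [hYs, zero_mul, zero_mul, sub_zero, sub_zero]
    rcases lt_or_gt_of_ne hij with hsj | hsj
    · rw [show Z j = _ from if_pos hsj, mul_inv_cancel_left₀ hpiv, sub_self]
    · rw [hy0 _ j hij (Or.inr hsj), show Z j = 0 from if_neg hsj.not_gt, mul_zero, sub_zero]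
  · rw [hcol i his, zero_mul, sub_zero]
    by_cases hjs : j = s
    · rw [hjs]
      exact hcol i his
    · have hlt' : i < s ∨ j < s :=
        hlt.imp (fun h => lt_of_le_of_ne h his) fun h => lt_of_le_of_ne h hjs
      rw [hy0 i j hij hlt']
      rcases hlt' with h1 | h1
      · rw [show Y i = 0 from if_neg h1.not_gt, zero_mul, sub_zero]
      · rw [hy0 s j (Ne.symm hjs) (Or.inr h1), mul_zero, sub_zero]

/-- Gaussian elimination with pivots of maximal norm: the first `r` rows and columns of any `g` can be
cleared by integral unipotent matrices and permutation matrices. -/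
theorem exists_clear {M : Subgroup (GL (Fin m) D)} (hU : upperUnipotent F D m ⊆ M)
    (hs : ∀ a : Fin (m - 1), simpleReflection D a ∈ M) (g : GL (Fin m) D) (r : ℕ) (hr : r ≤ m) :
    ∃ l ∈ M, ∃ k ∈ M, ∀ i j : Fin m, i ≠ j → ((i : ℕ) < r ∨ (j : ℕ) < r) →
      ((l * g * k : GL (Fin m) D) : Matrix (Fin m) (Fin m) D) i j = 0 := by
  induction r with
  | zero => exact ⟨1, M.one_mem, 1, M.one_mem, fun i j _ h => by simp at h⟩
  | succ r ih =>
    obtain ⟨l, hl, k, hk, h⟩ := ih (by omega)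
    set s : Fin m := ⟨r, by omega⟩ with hs'
    set x := l * g * k with hx
    -- move an entry of maximal norm of the remaining block to the position `(s, s)`
    obtain ⟨p, hp, hmax⟩ := Finset.exists_max_image
      (Finset.univ.filter fun p : Fin m × Fin m => s ≤ p.1 ∧ s ≤ p.2)
      (fun p => normValuation F D ((x : Matrix (Fin m) (Fin m) D) p.1 p.2))
      ⟨(s, s), by simp⟩
    obtain ⟨hp1, hp2⟩ := (Finset.mem_filter.mp hp).2
    set y := permGL D (Equiv.swap s p.1) * x * permGL D (Equiv.swap s p.2) with hy
    have hyx : ∀ i j, (y : Matrix (Fin m) (Fin m) D) i j =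
        (x : Matrix (Fin m) (Fin m) D) (Equiv.swap s p.1 i) (Equiv.swap s p.2 j) := by
      intro i j
      rw [hy, mul_permGL_apply, permGL_mul_apply, Equiv.swap_inv]
    have hfix : ∀ {q i : Fin m}, s ≤ q → i < s → Equiv.swap s q i = i := fun hq hi =>
      Equiv.swap_apply_of_ne_of_ne hi.ne (hi.trans_le hq).ne
    have hge : ∀ {q i : Fin m}, s ≤ q → s ≤ i → s ≤ Equiv.swap s q i := by
      intro q i hq hi
      rw [Equiv.swap_apply_def]
      split_ifs
      exacts [hq, le_rfl, hi]
    have hy0 : ∀ i j, i ≠ j → (i < s ∨ j < s) → (y : Matrix (Fin m) (Fin m) D) i j = 0 := by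
      intro i j hij hlt
      rw [hyx]
      by_cases hi : i < s
      · rw [hfix hp1 hi]
        refine h _ _ ?_ (Or.inl hi)
        by_cases hj : j < s
        · rwa [hfix hp2 hj]
        · exact (hi.trans_le (hge hp2 (not_lt.mp hj))).ne
      · have hj : j < s := hlt.resolve_left hi
        rw [hfix hp2 hj]
        exact h _ _ (hj.trans_le (hge hp1 (not_lt.mp hi))).ne' (Or.inr hj)
    have hymax : ∀ i j, s ≤ i → s ≤ j → normValuation F D ((y : Matrix (Fin m) (Fin m) D) i j) ≤
        normValuation F D ((y : Matrix (Fin m) (Fin m) D) s s) := by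
      intro i j hi hj
      rw [hyx, hyx, Equiv.swap_apply_left, Equiv.swap_apply_left]
      exact hmax (_, _) (Finset.mem_filter.mpr ⟨Finset.mem_univ _, hge hp1 hi, hge hp2 hj⟩)
    obtain ⟨l', hl', k', hk', h'⟩ := exists_clear_pivot hU hs hy0 hymax
    refine ⟨l' * (permGL D (Equiv.swap s p.1) * l), M.mul_mem hl' (M.mul_mem (permGL_mem hs _) hl),
      k * permGL D (Equiv.swap s p.2) * k', M.mul_mem (M.mul_mem hk (permGL_mem hs _)) hk',
      fun i j hij hlt => ?_⟩
    have e : l' * (permGL D (Equiv.swap s p.1) * l) * g *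
        (k * permGL D (Equiv.swap s p.2) * k') = l' * y * k' := by
      rw [hy, hx]
      group
    rw [e]
    exact h' i j hij (hlt.imp (fun h => Fin.le_def.mpr (by rw [hs']; exact Nat.lt_succ_iff.mp h))
      fun h => Fin.le_def.mpr (by rw [hs']; exact Nat.lt_succ_iff.mp h))

theorem exists_mul_mul_eq_diagonalGL {M : Subgroup (GL (Fin m) D)} (hU : upperUnipotent F D m ⊆ M)
    (hs : ∀ a : Fin (m - 1), simpleReflection D a ∈ M) (g : GL (Fin m) D) :
    ∃ l ∈ M, ∃ k ∈ M, ∃ d : Fin m → Dˣ, l * g * k = diagonalGL d := by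
  obtain ⟨l, hl, k, hk, h⟩ := exists_clear hU hs g m le_rfl
  exact ⟨l, hl, k, hk, exists_eq_diagonalGL fun i j hij => h i j hij (Or.inl i.2)⟩

end Elimination

section Generation

variable {F : Type*} [Field F] [ValuativeRel F] [TopologicalSpace F] [IsNonarchimedeanLocalField F]
variable {D : Type*} [DivisionRing D] [Algebra F D] [FiniteDimensional F D] {m : ℕ}

/-! ### The functions `f_k` for `k ∈ K` -/

theorem char_mul_char_of_left_mem {k : GL (Fin m) D} (hk : k ∈ maxCompact F D m)
    (g : GL (Fin m) D) :
    HeckeAlgebra.char (proRadical F D m) k * HeckeAlgebra.char (proRadical F D m) g =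
      HeckeAlgebra.char (proRadical F D m) (k * g) :=
  HeckeAlgebra.char_mul_char_of_left (mem_proRadical_iff_conj hk) g

theorem char_mul_char_of_right_mem (g : GL (Fin m) D) {k : GL (Fin m) D}
    (hk : k ∈ maxCompact F D m) :
    HeckeAlgebra.char (proRadical F D m) g * HeckeAlgebra.char (proRadical F D m) k =
      HeckeAlgebra.char (proRadical F D m) (g * k) :=
  HeckeAlgebra.char_mul_char_of_right g (mem_proRadical_iff_conj hk)

variable (F D m) in
theorem finite_char_image_maxCompact :
    (HeckeAlgebra.char (proRadical F D m) '' (maxCompact F D m : Set (GL (Fin m) D))).Finite := by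
  obtain ⟨π, hπ0, hπ1, hπ⟩ := exists_uniformizer F
  obtain ⟨R, hR, hR'⟩ := exists_finite_mod_pow F D hπ0 hπ 1
  have hlt : (valuation F π ^ Module.finrank F D) ^ 1 < 1 := by
    rw [pow_one]
    exact pow_lt_one₀ zero_le hπ1 Module.finrank_pos.ne'
  choose! r hrR hr using hR'
  have hex : ∀ Φ ∈ HeckeAlgebra.char (proRadical F D m) '' (maxCompact F D m : Set (GL (Fin m) D)),
      ∃ k, k ∈ maxCompact F D m ∧ HeckeAlgebra.char (proRadical F D m) k = Φ := fun Φ h => h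
  choose! κ hκ hκ' using hex
  refine Set.Finite.of_injOn (f := fun Φ => fun i j => r ((κ Φ : Matrix (Fin m) (Fin m) D) i j))
    (t := Set.univ.pi fun _ => Set.univ.pi fun _ => R) ?_ ?_ ?_
  · intro Φ hΦ i _ j _
    exact hrR _ ((hκ Φ hΦ).1 i j)
  · intro Φ hΦ Ψ hΨ heq
    have hmem : (κ Φ)⁻¹ * κ Ψ ∈ proRadical F D m := by
      refine inv_mul_mem_proRadical_of_sub_lt (hκ Φ hΦ) fun i j => ?_
      have h1 := hr _ ((hκ Φ hΦ).1 i j)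
      have h2 := hr _ ((hκ Ψ hΨ).1 i j)
      have h3 : r ((κ Φ : Matrix (Fin m) (Fin m) D) i j) =
          r ((κ Ψ : Matrix (Fin m) (Fin m) D) i j) := congrFun (congrFun heq i) j
      rw [h3] at h1
      rw [Matrix.sub_apply, ← sub_sub_sub_cancel_right _ _ (r ((κ Ψ : Matrix _ _ D) i j))]
      exact (Valuation.map_sub _ _ _).trans_lt (max_lt (h2.trans_lt hlt) (h1.trans_lt hlt))
    rw [← hκ' Φ hΦ, ← hκ' Ψ hΨ, ← HeckeAlgebra.char_mul_right (κ Φ) hmem, mul_inv_cancel_left]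
  · exact Set.Finite.pi fun _ => Set.Finite.pi fun _ => hR

/-- The elements `k` of `K` such that `f_k` lies in a given subalgebra. They form a group since the
elements `f_k` have finite order. -/
def charMemSubgroup (A : Subalgebra ℤ (HeckeAlgebra (proRadical F D m))) :
    Subgroup (GL (Fin m) D) where
  carrier := {k | k ∈ maxCompact F D m ∧ HeckeAlgebra.char (proRadical F D m) k ∈ A}
  one_mem' := ⟨one_mem _, A.one_mem⟩
  mul_mem' := by
    rintro a b ⟨ha, ha'⟩ ⟨hb, hb'⟩
    exact ⟨mul_mem ha hb, char_mul_char_of_left_mem ha b ▸ A.mul_mem ha' hb'⟩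
  inv_mem' := by
    rintro k ⟨hk, hk'⟩
    refine ⟨inv_mem hk, ?_⟩
    have hpow : ∀ n : ℕ, HeckeAlgebra.char (proRadical F D m) (k ^ n) =
        HeckeAlgebra.char (proRadical F D m) k ^ n := by
      intro n
      induction n with
      | zero =>
        rw [pow_zero, pow_zero]
        rfl
      | succ n ih => rw [pow_succ, pow_succ, ← ih, char_mul_char_of_right_mem _ hk]
    have := (finite_char_image_maxCompact F D m).to_subtype
    obtain ⟨a, b, hab, h⟩ := Finite.exists_ne_map_eq_of_infinite
      (fun n : ℕ => (⟨_, k ^ n, pow_mem hk n, rfl⟩ : HeckeAlgebra.char (proRadical F D m) ''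
        (maxCompact F D m : Set (GL (Fin m) D))))
    have h : HeckeAlgebra.char (proRadical F D m) (k ^ a) =
        HeckeAlgebra.char (proRadical F D m) (k ^ b) := congrArg Subtype.val h
    have key : ∀ a b : ℕ, a < b → HeckeAlgebra.char (proRadical F D m) (k ^ a) =
        HeckeAlgebra.char (proRadical F D m) (k ^ b) →
          HeckeAlgebra.char (proRadical F D m) k⁻¹ ∈ A := by
      intro a b hlt h
      obtain ⟨c, rfl⟩ := Nat.exists_eq_add_of_lt hlt
      have e : HeckeAlgebra.char (proRadical F D m) k⁻¹ =
          HeckeAlgebra.char (proRadical F D m) k ^ c := by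
        have hmem : (k ^ (a + 1))⁻¹ ∈ maxCompact F D m := inv_mem (pow_mem hk _)
        calc _ = HeckeAlgebra.char (proRadical F D m) ((k ^ (a + 1))⁻¹ * k ^ a) := by
              congr 1
              rw [pow_succ', _root_.mul_inv_rev]
              group
          _ = HeckeAlgebra.char (proRadical F D m) ((k ^ (a + 1))⁻¹ * k ^ (a + c + 1)) := by
              rw [← char_mul_char_of_left_mem hmem, ← char_mul_char_of_left_mem hmem, h]
          _ = _ := by
              rw [show a + c + 1 = (a + 1) + c by omega, pow_add k (a + 1) c, inv_mul_cancel_left, hpow]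
      rw [e]
      exact A.pow_mem hk' c
    rcases lt_or_gt_of_ne hab with hlt | hlt
    · exact key a b hlt h
    · exact key b a hlt h.symm

theorem char_mem_supportedIn {k : GL (Fin m) D} (hk : k ∈ maxCompact F D m) :
    HeckeAlgebra.char (proRadical F D m) k ∈
      HeckeAlgebra.supportedIn (maxCompact F D m) (proRadical_le_maxCompact F D m) := by
  intro g hg
  refine HeckeAlgebra.char_apply_of_notMem fun hm => hg ?_
  obtain ⟨a, ha, b, hb, rfl⟩ := mem_doubleCoset.mp hm
  exact mul_mem (mul_mem (proRadical_le_maxCompact F D m ha) hk) (proRadical_le_maxCompact F D m hb)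

theorem mem_of_char_mem_subalgebra {A : Subalgebra ℤ (HeckeAlgebra (proRadical F D m))}
    {Φ : HeckeAlgebra (proRadical F D m)}
    (h : ∀ g, Φ g ≠ 0 → HeckeAlgebra.char (proRadical F D m) g ∈ A) : Φ ∈ A :=
  HeckeAlgebra.mem_of_char_mem (Subalgebra.toSubring A).toAddSubgroup Φ h

theorem normValuation_integerRing_unit (u : (integerRing F D)ˣ) :
    normValuation F D ((u : integerRing F D) : D) = 1 := by
  refine le_antisymm (u : integerRing F D).2 ?_
  have h : normValuation F D ((u : integerRing F D) : D) *
      normValuation F D (((u⁻¹ : (integerRing F D)ˣ) : integerRing F D) : D) = 1 := by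
    rw [← map_mul, ← Subring.coe_mul, Units.mul_inv, Subring.coe_one, map_one]
  rw [← h]
  exact mul_le_of_le_one_right' ((u⁻¹ : (integerRing F D)ˣ) : integerRing F D).2

theorem diagonalTorus_subset_maxCompact (σ : (ResidueRing F D)ˣ →* (integerRing F D)ˣ) :
    diagonalTorus F m σ ⊆ maxCompact F D m := by
  rintro _ ⟨a, rfl⟩
  exact diagonalGL_mem_maxCompact fun i => normValuation_integerRing_unit _

/-- Modulo `K¹`, every diagonal matrix in `K` lies in `T`. -/
theorem exists_diagonalTorus_char_eq {σ : (ResidueRing F D)ˣ →* (integerRing F D)ˣ}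
    (hσ : IsMultiplicativeSection F D σ) {d : Fin m → Dˣ}
    (hd : diagonalGL d ∈ maxCompact F D m) : ∃ t ∈ diagonalTorus F m σ,
      HeckeAlgebra.char (proRadical F D m) (diagonalGL d) =
        HeckeAlgebra.char (proRadical F D m) t := by
  have h1 : ∀ i, (d i : D) ∈ integerRing F D := fun i => by
    have := hd.1 i i
    rwa [coe_diagonalGL, diagonal_apply_eq] at this
  have h2 : ∀ i, (((d i)⁻¹ : Dˣ) : D) ∈ integerRing F D := fun i => by
    have := hd.2 i i
    rwa [diagonalGL_inv, coe_diagonalGL, diagonal_apply_eq] at this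
  let u : Fin m → (integerRing F D)ˣ := fun i =>
    ⟨⟨_, h1 i⟩, ⟨_, h2 i⟩, Subtype.ext (Units.mul_inv _), Subtype.ext (Units.inv_mul _)⟩
  let a : Fin m → (ResidueRing F D)ˣ := fun i => Units.map
    (Ideal.Quotient.mk (primeIdeal F D) : integerRing F D →* ResidueRing F D) (u i)
  refine ⟨_, ⟨a, rfl⟩, ?_⟩
  set t : GL (Fin m) D := diagonalGL fun i =>
    Units.map ((integerRing F D).subtype : integerRing F D →* D) (σ (a i)) with ht
  have hmem : t⁻¹ * diagonalGL d ∈ proRadical F D m := by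
    refine inv_mul_mem_proRadical_of_sub_lt (diagonalTorus_subset_maxCompact σ ⟨a, rfl⟩)
      fun i j => ?_
    rw [ht, coe_diagonalGL, coe_diagonalGL, diagonal_sub, diagonal_apply]
    split_ifs
    · have e : Ideal.Quotient.mk (primeIdeal F D) (u i : integerRing F D) =
          Ideal.Quotient.mk (primeIdeal F D) (σ (a i) : integerRing F D) :=
        (congrArg Units.val (hσ (a i))).symm
      exact mem_primeIdeal F |>.mp (Ideal.Quotient.eq.mp e)
    · simp
  rw [← HeckeAlgebra.char_mul_right t hmem, mul_inv_cancel_left]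

/-- `ℋ(K, K¹)` is generated by the functions `f_u`, `f_t` and `f_{s_α}`. -/
theorem adjoin_char_eq_supportedIn {σ : (ResidueRing F D)ˣ →* (integerRing F D)ˣ}
    (hσ : IsMultiplicativeSection F D σ) :
    Algebra.adjoin ℤ (HeckeAlgebra.char (proRadical F D m) ''
      (upperUnipotent F D m ∪ diagonalTorus F m σ ∪
        Set.range fun a : Fin (m - 1) => simpleReflection D a)) =
      HeckeAlgebra.supportedIn (maxCompact F D m) (proRadical_le_maxCompact F D m) := by
  set W := upperUnipotent F D m ∪ diagonalTorus F m σ ∪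
    Set.range fun a : Fin (m - 1) => simpleReflection D a with hW
  set A := Algebra.adjoin ℤ (HeckeAlgebra.char (proRadical F D m) '' W) with hA
  have hWK : W ⊆ maxCompact F D m := by
    rintro _ ((hu | ht) | ⟨a, rfl⟩)
    · exact hu.1
    · exact diagonalTorus_subset_maxCompact σ ht
    · exact simpleReflection_mem_maxCompact a
  have hWA : W ⊆ charMemSubgroup A := fun w hw =>
    ⟨hWK hw, Algebra.subset_adjoin (Set.mem_image_of_mem _ hw)⟩
  refine le_antisymm (Algebra.adjoin_le ?_) fun Φ hΦ => ?_
  · rintro _ ⟨w, hw, rfl⟩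
    exact char_mem_supportedIn (hWK hw)
  · refine mem_of_char_mem_subalgebra fun k hk0 => ?_
    have hk : k ∈ maxCompact F D m := by
      by_contra h
      exact hk0 (hΦ k h)
    obtain ⟨l, hl, r, hr, d, hd⟩ := exists_mul_mul_eq_diagonalGL (M := charMemSubgroup A)
      (fun u hu => hWA (Or.inl (Or.inl hu))) (fun a => hWA (Or.inr ⟨a, rfl⟩)) k
    have hdK : diagonalGL d ∈ maxCompact F D m := hd ▸ mul_mem (mul_mem hl.1 hk) hr.1
    obtain ⟨t, ht, hdt⟩ := exists_diagonalTorus_char_eq hσ hdK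
    have hdM : diagonalGL d ∈ charMemSubgroup A :=
      ⟨hdK, hdt ▸ (hWA (Or.inl (Or.inr ht))).2⟩
    have : k = l⁻¹ * diagonalGL d * r⁻¹ := by
      rw [← hd]
      group
    rw [this]
    exact (mul_mem (mul_mem (inv_mem hl) hdM) (inv_mem hr)).2

/-! ### The Cartan decomposition and generation of `ℋ(G, K¹)` -/

theorem IsUniformizer.normValuation_lt_one {ϖ : Dˣ} (hϖ : IsUniformizer F (ϖ : D)) :
    normValuation F D (ϖ : D) < 1 :=
  (hϖ _).mpr ⟨1, one_mem _, (mul_one _).symm⟩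

/-- Every element of `D^×` is a power of the uniformizer times a unit. -/
theorem IsUniformizer.exists_zpow_mul {ϖ : Dˣ} (hϖ : IsUniformizer F (ϖ : D)) (d : Dˣ) :
    ∃ n : ℤ, normValuation F D ((ϖ ^ n * d : Dˣ) : D) = 1 := by
  have : MulArchimedean (ValueGroupWithZero F) :=
    ValuativeRel.isRankLeOne_iff_mulArchimedean.mp inferInstance
  let v : Dˣ →* (ValueGroupWithZero F)ˣ :=
    Units.map (normValuation F D : D →* ValueGroupWithZero F)
  have hv : ∀ x : Dˣ, ((v x : (ValueGroupWithZero F)ˣ) : ValueGroupWithZero F) =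
      normValuation F D (x : D) := fun _ => rfl
  have h1 : 1 < (v ϖ)⁻¹ := by
    rw [one_lt_inv', ← Units.val_lt_val, hv]
    exact hϖ.normValuation_lt_one
  obtain ⟨n, ⟨hn1, hn2⟩, -⟩ := existsUnique_zpow_near_of_one_lt h1 (v d)
  refine ⟨n, ?_⟩
  rw [← hv, ← Units.val_one, Units.val_inj]
  refine le_antisymm ?_ ?_
  · have h2 : v (ϖ ^ (n + 1) * d) < 1 := by
      rw [map_mul, map_zpow]
      calc _ < v ϖ ^ (n + 1) * (v ϖ)⁻¹ ^ (n + 1) := by gcongr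
        _ = 1 := by rw [_root_.inv_zpow, mul_inv_cancel]
    rw [← Units.val_lt_val, hv] at h2
    obtain ⟨y, hy, hxy⟩ := (hϖ _).mp h2
    have hy' : ((ϖ ^ n * d : Dˣ) : D) = y := by
      rw [_root_.zpow_add_one, ← (Commute.refl ϖ).zpow_right n |>.eq, mul_assoc, Units.val_mul] at hxy
      exact mul_left_cancel₀ ϖ.ne_zero hxy
    rw [← Units.val_le_val, hv, hy']
    exact hy
  · rw [map_mul, map_zpow]
    calc (1 : (ValueGroupWithZero F)ˣ) = v ϖ ^ n * (v ϖ)⁻¹ ^ n := by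
          rw [_root_.inv_zpow, mul_inv_cancel]
      _ ≤ _ := by gcongr

/-- The Cartan decomposition: `G` is the union of the `K δ K`, where `δ` is a diagonal matrix of
powers of `ϖ` with increasing exponents. -/
theorem IsUniformizer.exists_cartan {ϖ : Dˣ} (hϖ : IsUniformizer F (ϖ : D)) (g : GL (Fin m) D) :
    ∃ k ∈ maxCompact F D m, ∃ k' ∈ maxCompact F D m, ∃ n : Fin m → ℤ, Monotone n ∧
      g = k * diagonalGL (fun i => ϖ ^ n i) * k' := by
  obtain ⟨l, hl, r, hr, d, hd⟩ := exists_mul_mul_eq_diagonalGL (F := F) (M := maxCompact F D m)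
    (fun u hu => hu.1) simpleReflection_mem_maxCompact g
  choose n hn using fun i => hϖ.exists_zpow_mul (d i)
  -- `ϖ ^ n i * d i` is a unit, so that `-n i` is the exponent of `d i`
  set σ := Tuple.sort fun i => -n i with hσ
  set u : GL (Fin m) D := diagonalGL fun i => ϖ ^ n i * d i with hu
  have huK : u ∈ maxCompact F D m := diagonalGL_mem_maxCompact hn
  refine ⟨l⁻¹ * permGL D σ, mul_mem (inv_mem hl) (permGL_mem_maxCompact σ),
    (permGL D σ)⁻¹ * u * r⁻¹, mul_mem (mul_mem (inv_mem (permGL_mem_maxCompact σ)) huK)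
      (inv_mem hr), fun i => -n (σ i), Tuple.monotone_sort fun i => -n i, ?_⟩
  have h1 : permGL D σ * diagonalGL (fun i => ϖ ^ (-n (σ i))) =
      diagonalGL (fun i => ϖ ^ (-n i)) * permGL D σ := by
    ext i j
    rw [permGL_mul_apply, mul_permGL_apply, coe_diagonalGL, coe_diagonalGL, diagonal_apply,
      diagonal_apply]
    by_cases hij : i = σ j
    · simp [hij]
    · rw [if_neg hij, if_neg]
      rintro rfl
      simp at hij
  have h2 : diagonalGL d = diagonalGL (fun i => ϖ ^ (-n i)) * u := by
    rw [hu, diagonalGL_mul]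
    simp
  calc g = l⁻¹ * diagonalGL d * r⁻¹ := by
        rw [← hd]
        group
    _ = l⁻¹ * (diagonalGL (fun i => ϖ ^ (-n i)) * permGL D σ) * (permGL D σ)⁻¹ * u * r⁻¹ := by
        rw [h2]
        group
    _ = _ := by
        rw [← h1]
        group

theorem mem_proRadical_iff_conj_scalar (c : Dˣ) (h : GL (Fin m) D) : h ∈ proRadical F D m ↔
    diagonalGL (fun _ => c) * h * (diagonalGL fun _ => c)⁻¹ ∈ proRadical F D m := by
  rw [mem_proRadical_iff, mem_proRadical_iff]
  refine forall_congr' fun i => forall_congr' fun j => ?_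
  rw [normValuation_diagonalGL_conj, mul_right_comm,
    mul_inv_cancel₀ (normValuation_unit_pos (F := F) c).ne', one_mul]

theorem tau_zero (ϖ : Dˣ) : tau m ϖ 0 = diagonalGL fun _ => ϖ := by
  simp [tau]

theorem char_scalar_mem {ϖ : Dˣ} {A : Subalgebra ℤ (HeckeAlgebra (proRadical F D m))}
    (h1 : HeckeAlgebra.char (proRadical F D m) (tau m ϖ 0) ∈ A)
    (h2 : HeckeAlgebra.char (proRadical F D m) (tau m ϖ 0)⁻¹ ∈ A) (n : ℤ) :
    HeckeAlgebra.char (proRadical F D m) (diagonalGL fun _ => ϖ ^ n) ∈ A := by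
  rw [tau_zero] at h1 h2
  rw [diagonalGL_inv] at h2
  induction n with
  | zero =>
    have : diagonalGL (fun _ : Fin m => ϖ ^ (0 : ℤ)) = 1 := by
      ext i j
      simp [coe_diagonalGL]
    rw [this]
    exact A.one_mem
  | succ n ih =>
    have := A.mul_mem ih h1
    rw [HeckeAlgebra.char_mul_char_of_right _ (mem_proRadical_iff_conj_scalar _),
      diagonalGL_mul] at this
    simpa only [_root_.zpow_add_one] using this
  | pred n ih =>
    have := A.mul_mem ih h2
    rw [HeckeAlgebra.char_mul_char_of_right _ (mem_proRadical_iff_conj_scalar _),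
      diagonalGL_mul] at this
    simpa only [_root_.zpow_sub_one] using this

/-- A diagonal matrix of powers of `ϖ` with increasing exponents is a product of a power of `τ_0` and
of the `τ_α`; by multiplicativity its characteristic function lies in the generated subalgebra. -/
theorem char_diagonalGL_zpow_mem {ϖ : Dˣ} (h0 : normValuation F D (ϖ : D) < 1)
    {A : Subalgebra ℤ (HeckeAlgebra (proRadical F D (m + 1)))}
    (h1 : HeckeAlgebra.char (proRadical F D (m + 1)) (tau (m + 1) ϖ 0) ∈ A)
    (h2 : HeckeAlgebra.char (proRadical F D (m + 1)) (tau (m + 1) ϖ 0)⁻¹ ∈ A)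
    (h3 : ∀ a : Fin m, HeckeAlgebra.char (proRadical F D (m + 1)) (tau (m + 1) ϖ (a + 1)) ∈ A)
    {n : Fin (m + 1) → ℤ} (hn : Monotone n) :
    HeckeAlgebra.char (proRadical F D (m + 1)) (diagonalGL fun i => ϖ ^ n i) ∈ A := by
  obtain ⟨N, hN⟩ : ∃ N : ℕ, n (Fin.last m) = n 0 + N :=
    ⟨(n (Fin.last m) - n 0).toNat, by have := hn (Fin.zero_le (Fin.last m)); omega⟩
  induction N generalizing n with
  | zero =>
    have : n = fun _ => n 0 := by
      ext i
      have h4 := hn (Fin.zero_le i)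
      have h5 := hn (Fin.le_last i)
      omega
    rw [this]
    exact char_scalar_mem h1 h2 _
  | succ N ih =>
    -- lower the exponents equal to the largest one by `1`; they sit at the positions `i ≥ r`
    obtain ⟨r, hr, hrmin⟩ := WellFounded.has_min (wellFounded_lt (α := Fin (m + 1)))
      {i | n i = n (Fin.last m)} ⟨Fin.last m, rfl⟩
    have hr : n r = n (Fin.last m) := hr
    have hr0 : r ≠ 0 := by
      rintro rfl
      omega
    obtain ⟨a, rfl⟩ := Fin.exists_succ_eq.mpr hr0
    set n' : Fin (m + 1) → ℤ := fun i => min (n i) (n (Fin.last m) - 1) with hn'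
    have hmono : Monotone n' := fun i j hij => min_le_min_right _ (hn hij)
    have hmem : HeckeAlgebra.char (proRadical F D (m + 1)) (diagonalGL fun i => ϖ ^ n' i) ∈ A := by
      refine ih hmono ?_
      simp only [hn']
      omega
    have hprod : (diagonalGL fun i => ϖ ^ n i) =
        diagonalGL (fun i => ϖ ^ n' i) * tau (m + 1) ϖ (a + 1) := by
      rw [tau, diagonalGL_mul]
      congr 1
      ext1 i
      have hle := hn (Fin.le_last i)
      split_ifs with hi
      · have hne : n i ≠ n (Fin.last m) := fun h => hrmin i h (Fin.lt_def.mpr hi)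
        rw [mul_one, show n' i = n i from min_eq_left (by omega)]
      · have heq : n i = n (Fin.last m) := by
          have := hn (show a.succ ≤ i from Fin.le_def.mpr (by simpa using hi))
          omega
        rw [show n' i = n (Fin.last m) - 1 from min_eq_right (by omega), ← _root_.zpow_add_one, heq,
          sub_add_cancel]
    rw [hprod, ← char_diagonalGL_mul_char_tau _ h0]
    · exact A.mul_mem hmem (h3 a)
    · intro i j hij
      rw [Units.val_zpow_eq_zpow_val, Units.val_zpow_eq_zpow_val, map_zpow₀, map_zpow₀]
      exact zpow_le_zpow_right_of_le_one₀ (normValuation_unit_pos ϖ) h0.le (hmono hij)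

theorem finite_char_image_generatorSet (ϖ : Dˣ) :
    (HeckeAlgebra.char (proRadical F D m) '' generatorSet F D m ϖ).Finite := by
  rw [generatorSet, Set.image_union, Set.image_union]
  exact ((finite_char_image_maxCompact F D m).union ((Set.toFinite _).image _)).union
    ((Set.finite_range _).image _)

theorem adjoin_char_generatorSet (hm : 0 < m) {ϖ : Dˣ} (hϖ : IsUniformizer F (ϖ : D)) :
    Algebra.adjoin ℤ (HeckeAlgebra.char (proRadical F D m) '' generatorSet F D m ϖ) = ⊤ := by
  obtain ⟨m, rfl⟩ := Nat.exists_eq_succ_of_ne_zero hm.ne'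
  have hmem : ∀ ω ∈ generatorSet F D (m + 1) ϖ, HeckeAlgebra.char (proRadical F D (m + 1)) ω ∈
      Algebra.adjoin ℤ (HeckeAlgebra.char (proRadical F D (m + 1)) ''
        generatorSet F D (m + 1) ϖ) :=
    fun ω hω => Algebra.subset_adjoin (Set.mem_image_of_mem _ hω)
  refine eq_top_iff.mpr fun Φ _ => mem_of_char_mem_subalgebra fun g _ => ?_
  obtain ⟨k, hk, k', hk', n, hn, rfl⟩ := hϖ.exists_cartan g
  rw [← char_mul_char_of_right_mem _ hk', ← char_mul_char_of_left_mem hk]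
  refine mul_mem (mul_mem (hmem k (Or.inl (Or.inl hk))) ?_) (hmem k' (Or.inl (Or.inl hk')))
  exact char_diagonalGL_zpow_mem hϖ.normValuation_lt_one
    (hmem _ (Or.inl (Or.inr (Or.inl rfl)))) (hmem _ (Or.inl (Or.inr (Or.inr rfl))))
    (fun a => hmem _ (Or.inr ⟨a, rfl⟩)) hn

end Generation

end GLHecke

theorem mainTheorem3 {F : Type*} [Field F] [ValuativeRel F] [TopologicalSpace F]
    [IsNonarchimedeanLocalField F] {D : Type*} [DivisionRing D] [Algebra F D]
    [FiniteDimensional F D] [Algebra.IsCentral F D] (m : ℕ) (hm : 0 < m) (ϖ : Dˣ)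
    (hϖ : GLHecke.IsUniformizer F (ϖ : D)) :
    (HeckeAlgebra.char (GLHecke.proRadical F D m) '' GLHecke.generatorSet F D m ϖ).Finite ∧
    Algebra.adjoin ℤ
      (HeckeAlgebra.char (GLHecke.proRadical F D m) '' GLHecke.generatorSet F D m ϖ) = ⊤ ∧
    ∀ σ : (GLHecke.ResidueRing F D)ˣ →* (GLHecke.integerRing F D)ˣ,
      GLHecke.IsMultiplicativeSection F D σ →
      Algebra.adjoin ℤ (HeckeAlgebra.char (GLHecke.proRadical F D m) ''
        (GLHecke.upperUnipotent F D m ∪ GLHecke.diagonalTorus F m σ ∪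
          Set.range fun a : Fin (m - 1) => GLHecke.simpleReflection D a)) =
        HeckeAlgebra.supportedIn (GLHecke.maxCompact F D m)
          (GLHecke.proRadical_le_maxCompact F D m) := by
  exact ⟨GLHecke.finite_char_image_generatorSet ϖ, GLHecke.adjoin_char_generatorSet hm hϖ,
    fun _ hσ => GLHecke.adjoin_char_eq_supportedIn hσ⟩
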